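/- Let $d\ge 1$, let $T\ge 1$ be an integer, and let $\mathcal L\subset\mathbb R^d$ be uniformly discrete (there is $r>0$ with $|x-y|\ge r$ for all distinct $x,y\in\mathcal L$) and $T$-periodic ($\mathcal L+Tz=\mathcal L$ for all $z\in\mathbb Z^d$). Let $c_{i,j}\ge 0$, $i,j\in\mathcal L$, satisfy (H1) $c_{i+Tz,\,j+Tz}=c_{i,j}$ for all $i,j\in\mathcal L$ and $z\in\mathbb Z^d$; (H2) $\sum_{j\in\mathcal L}c_{i,j}|i-j|<+\infty$ for all $i\in\mathcal L$. For $u\colon\mathcal L\to\mathbb R$ and $A\subset\mathbb R^d$ put $E(u,A)=\sum_{i\in\mathcal L\cap A}\sum_{j\in\mathcal L}c_{i,j}\,(u(i)-u(j))^+$. Let $Q_\rho=[-\rho/2,\rho/2)^d$. For every unit vector $\nu$ fix an orthogonal map $R^\nu$ of $\mathbb R^d$ with $R^\nu e_d=\nu$, and put $Q^\nu_\rho=R^\nu Q_\rho$; let $u_\nu(x)=1$ if $\langle\nu,x\rangle\ge 0$ and $u_\nu(x)=0$ otherwise. Then there is exactly one function $\varphi\colon\mathbb R^d\to[0,+\infty)$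 (the homogenized surface energy density) that is convex, positively homogeneous of degree one, and satisfies, for every unit vector $\nu$, $$\varphi(\nu)=\lim_{\delta\to0^+}\lim_{S\to+\infty}\frac1{S^{d-1}}\inf\Big\{E(u,Q^\nu_S)\colon u\colon\mathcal L\to\{0,1\},\ u(i)=u_\nu(i)\text{ for all } i\in\mathcal L\setminus Q^\nu_{(1-\delta)S}\Big\},$$ where the inner limit exists for every $\delta\in(0,1)$. Moreover, for every $\nu\in\mathbb R^d$, $$\varphi(\nu)=\frac1{T^d}\inf\Big\{E(u,Q_T)\colon u\colon\mathcal L\to\mathbb R,\ u(x+Tz)-\langle\nu,x+Tz\rangle=u(x)-\langle\nu,x\rangle\text{ for all }x\in\mathcal L,\ z\in\mathbb Z^d\Big\}.$$ -/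

import Mathlib

open Filter Topology
open scoped NNReal ENNReal

noncomputable section

namespace SpinHomogenization

/-- Euclidean space `ℝ^d` with `d = n + 1` (so that `d ≥ 1` and `d - 1 = n`). -/
abbrev Space (n : ℕ) : Type := EuclideanSpace ℝ (Fin (n + 1))

/-- The vector `T z`, for `z ∈ ℤ^d`. -/
def shift {n : ℕ} (T : ℕ) (z : Fin (n + 1) → ℤ) : Space n :=
  WithLp.toLp 2 (fun k => (T : ℝ) * (z k : ℝ))

/-- The last vector `e_d` of the standard basis. -/
def lastBasisVector (n : ℕ) : Space n := EuclideanSpace.single (Fin.last n) (1 : ℝ)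

/-- The half open cube `Q_ρ = [-ρ/2, ρ/2)^d`. -/
def cube (n : ℕ) (ρ : ℝ) : Set (Space n) := {x | ∀ k, -(ρ / 2) ≤ x k ∧ x k < ρ / 2}

/-- A choice, for every unit vector `ν`, of an orthogonal map `R^ν` with `R^ν e_d = ν`.
(For `d = 1` and `ν = -e_1` only the reflection is available, hence orthogonal maps of either
determinant are admitted.) -/
def IsFrameChoice {n : ℕ} (R : Space n → (Space n ≃ₗᵢ[ℝ] Space n)) : Prop :=
  ∀ ν : Space n, ‖ν‖ = 1 → R ν (lastBasisVector n) = ν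

/-- Uniform discreteness of the point set `L`. -/
def UniformlyDiscrete {n : ℕ} (L : Set (Space n)) : Prop :=
  ∃ r : ℝ, 0 < r ∧ ∀ x ∈ L, ∀ y ∈ L, x ≠ y → r ≤ dist x y

/-- `L + T z = L` for all `z ∈ ℤ^d`. -/
def PeriodicSet {n : ℕ} (T : ℕ) (L : Set (Space n)) : Prop :=
  ∀ z : Fin (n + 1) → ℤ, (fun x => x + shift T z) '' L = L

/-- `c_{i + Tz, j + Tz} = c_{i, j}` for all `i, j ∈ L`, `z ∈ ℤ^d`. -/
def PeriodicCoeff {n : ℕ} {L : Set (Space n)} (T : ℕ) (c : L → L → ℝ≥0) : Prop :=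
  ∀ (z : Fin (n + 1) → ℤ) (i j i' j' : L),
    (i' : Space n) = i + shift T z → (j' : Space n) = j + shift T z → c i' j' = c i j

/-- `∑_j c_{i, j} |i - j| < ∞` for every `i ∈ L`. -/
def DecayCoeff {n : ℕ} {L : Set (Space n)} (c : L → L → ℝ≥0) : Prop :=
  ∀ i : L, Summable (fun j : L => (c i j : ℝ) * ‖(i : Space n) - (j : Space n)‖)

/-- `E(u, A) = ∑_{i ∈ L ∩ A} ∑_{j ∈ L} c_{i, j} (u(i) - u(j))^+`, a sum of nonnegative terms with
value in `[0, ∞]`; `ENNReal.ofReal` is the positive part. -/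
def energy {n : ℕ} {L : Set (Space n)} (c : L → L → ℝ≥0) (u : L → ℝ) (A : Set (Space n)) : ℝ≥0∞ :=
  ∑' i : {i : L // (i : Space n) ∈ A}, ∑' j : L, (c i j : ℝ≥0∞) * ENNReal.ofReal (u i - u j)

/-- `u_ν(x) = 1` if `⟨ν, x⟩ ≥ 0` and `u_ν(x) = 0` otherwise. -/
def halfSpaceSpin {n : ℕ} (ν x : Space n) : ℝ := if 0 ≤ inner ℝ ν x then 1 else 0

/-- The infimum of `E(u, Q^ν_S)` over `u : L → {0, 1}` with `u = u_ν` on `L \ Q^ν_{(1-δ)S}`,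
where `Q^ν_ρ` is the image of `Q_ρ` under `Rν`. -/
def dirichletCell {n : ℕ} {L : Set (Space n)} (c : L → L → ℝ≥0)
    (Rν : Space n ≃ₗᵢ[ℝ] Space n) (ν : Space n) (δ S : ℝ) : ℝ≥0∞ :=
  ⨅ u ∈ {u : L → ℝ | (∀ i, u i = 0 ∨ u i = 1) ∧
      ∀ i : L, (i : Space n) ∉ Rν '' cube n ((1 - δ) * S) → u i = halfSpaceSpin ν i},
    energy c u (Rν '' cube n S)

/-- `φ : ℝ^d → [0, ∞)` is the homogenized surface energy density: it is convex, positively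
homogeneous of degree one, and on unit vectors it is the iterated limit
`lim_{δ → 0} lim_{S → ∞} S^{-(d-1)} inf {…}`, where `g δ` is the inner limit. -/
structure IsHomogenizedDensity {n : ℕ} {L : Set (Space n)} (c : L → L → ℝ≥0)
    (R : Space n → (Space n ≃ₗᵢ[ℝ] Space n)) (φ : Space n → ℝ≥0) : Prop where
  convex : ConvexOn ℝ Set.univ (fun ν => (φ ν : ℝ))
  homogeneous : ∀ (t : ℝ≥0) (ν : Space n), 0 < t → φ ((t : ℝ) • ν) = t * φ ν
  cell_limit : ∀ ν : Space n, ‖ν‖ = 1 → ∃ g : ℝ → ℝ≥0∞,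
    (∀ δ ∈ Set.Ioo (0 : ℝ) 1,
      Tendsto (fun S : ℝ => dirichletCell c (R ν) ν δ S / ENNReal.ofReal (S ^ n)) atTop
        (𝓝 (g δ))) ∧
    Tendsto g (𝓝[>] 0) (𝓝 (φ ν : ℝ≥0∞))

/-- The function `v` on `L` satisfies `v(x + T z) = v(x)` for all `x ∈ L`, `z ∈ ℤ^d`. -/
def PeriodicFun {n : ℕ} {L : Set (Space n)} (T : ℕ) (v : L → ℝ) : Prop :=
  ∀ (z : Fin (n + 1) → ℤ) (x y : L), (y : Space n) = x + shift T z → v y = v x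

/-- The infimum of `E(u, Q_T)` over `u : L → ℝ` such that `u - ⟨ν, ·⟩` is `T`-periodic. -/
def periodicCell {n : ℕ} {L : Set (Space n)} (T : ℕ) (c : L → L → ℝ≥0) (ν : Space n) : ℝ≥0∞ :=
  ⨅ u ∈ {u : L → ℝ | PeriodicFun T (fun i : L => u i - inner ℝ ν (i : Space n))},
    energy c u (cube n T)

end SpinHomogenization

end

noncomputable section

namespace SpinHomogenization

open MeasureTheory

variable {n : ℕ}

/-! Interface energies are counted along lattice translates of pairs `(i, j)`. If `v - ⟨ν, ·⟩` is
`T`-periodic, the set `{v ≥ t}` separates the translate of `(i, j)` by `Tz` exactly when the height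
`⟨ν, Tz⟩` lies in `[t - v i, t - v j)`. So everything rests on how the heights of lattice points in
a wide cylinder around `ν` are distributed. By `exists_limit_distribution`, the number with height
in `[a, b)`, per unit of cross section, tends to `G b - G a`, whatever the base point, and `G t - t
/ T^d` is periodic under every lattice height. `G` is linear if the heights are dense in `ℝ` and a
step function if they form a cyclic group.

Upper bound: this periodicity yields an exact coarea formula. The interface density of `{v ≥ t}`,
averaged over a period in `t`, is `E(v, Q_T) / T^d` (`IsLimitDistribution.lintegral_sub`), so some
level does no worse (`exists_levelDensity_le`). Use that level set in the cube of side `(1-δ)S` and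
the half space outside. The gluing costs only pairs crossing the boundary of the inner cube near the
hyperplane, which is `o(S^(d-1))` (`dirichletCell_upper_bound`).

Lower bound: given an admissible spin `u`, sum `u - u_ν` over all lattice translates and subtract
`(θS)^(d-1) G(-⟨ν, x⟩)`. The result is a competitor in the cell problem with slope `(θS)^(d-1)
T^(-d) ν`. The positive part of a sum is at most the sum of the positive parts, and the contribution
of `u_ν` cancels against `G` up to counting errors, so the cell energy is controlled by the energy
of `u` (`dirichletCell_lower_bound`). The buffer `1 - δ < θ` makes pairs reaching across it long,
hence controlled by (H2).

Together they give the inner limit exactly: `(1-δ)^(d-1)` times the cell value over `T^d`, plus `1 -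
(1-δ)^(d-1)` times the flat interface density. The second term vanishes as `δ → 0`. The cell value
is subadditive and homogeneous, hence convex; homogeneity and the values on the unit sphere give
uniqueness. -/

/-- The index set `ℤ^d` of the period lattice. -/
abbrev Idx (n : ℕ) : Type := Fin (n + 1) → ℤ

/-! ### Lattice vectors, heights and cylinders in a rotated frame. -/

theorem shift_apply (T : ℕ) (z : Idx n) (k : Fin (n + 1)) : shift T z k = (T : ℝ) * (z k : ℝ) := rfl

theorem shift_add (T : ℕ) (z w : Idx n) : shift T (z + w) = shift T z + shift T w := by
  ext k; simp [shift_apply, mul_add]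

theorem shift_neg (T : ℕ) (z : Idx n) : shift T (-z) = -shift T z := by
  ext k; simp [shift_apply]

theorem shift_zero (T : ℕ) : shift T (0 : Idx n) = 0 := by
  ext k; simp [shift_apply]

/-- The coordinate of `x` along the axis `R e_d`. -/
def height (R : Space n ≃ₗᵢ[ℝ] Space n) (x : Space n) : ℝ := R.symm x (Fin.last n)

/-- The infinite cylinder with axis `R e_d` over a cube of side `S`. -/
def cyl (R : Space n ≃ₗᵢ[ℝ] Space n) (S : ℝ) : Set (Space n) :=
  {x | ∀ k : Fin n, -(S / 2) ≤ R.symm x k.castSucc ∧ R.symm x k.castSucc < S / 2}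

/-- The part of the cylinder `cyl R S` at heights in `[a, b)`. -/
def slabBox (R : Space n ≃ₗᵢ[ℝ] Space n) (S a b : ℝ) : Set (Space n) :=
  {x | x ∈ cyl R S ∧ a ≤ height R x ∧ height R x < b}

/-- The indices `z` with `x + T z` in the cylinder `cyl R S` and `T z` at height in `[a, b)`. -/
def slabSet (R : Space n ≃ₗᵢ[ℝ] Space n) (T : ℕ) (S : ℝ) (x : Space n) (a b : ℝ) : Set (Idx n) :=
  {z | x + shift T z ∈ cyl R S ∧ a ≤ height R (shift T z) ∧ height R (shift T z) < b}

theorem height_add (R : Space n ≃ₗᵢ[ℝ] Space n) (x y : Space n) :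
    height R (x + y) = height R x + height R y := by simp [height]

theorem height_neg (R : Space n ≃ₗᵢ[ℝ] Space n) (x : Space n) :
    height R (-x) = -height R x := by simp [height]

theorem height_sub (R : Space n ≃ₗᵢ[ℝ] Space n) (x y : Space n) :
    height R (x - y) = height R x - height R y := by simp [height]

theorem abs_coord_le (R : Space n ≃ₗᵢ[ℝ] Space n) (x : Space n) (k : Fin (n + 1)) :
    |R.symm x k| ≤ ‖x‖ := by
  have := PiLp.norm_apply_le (R.symm x) k
  simpa using this

theorem abs_height_le (R : Space n ≃ₗᵢ[ℝ] Space n) (x : Space n) : |height R x| ≤ ‖x‖ :=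
  abs_coord_le R x _

theorem inner_eq_height {R : Space n ≃ₗᵢ[ℝ] Space n} {ν : Space n}
    (hR : R (lastBasisVector n) = ν) (x : Space n) : inner ℝ ν x = height R x := by
  rw [← hR, ← R.apply_symm_apply x, R.inner_map_map, R.apply_symm_apply]
  simp [lastBasisVector, height, EuclideanSpace.inner_single_left]

theorem mem_image_cube {R : Space n ≃ₗᵢ[ℝ] Space n} {S : ℝ} {x : Space n} :
    x ∈ R '' cube n S ↔ x ∈ cyl R S ∧ -(S / 2) ≤ height R x ∧ height R x < S / 2 := by
  have : x ∈ R '' cube n S ↔ R.symm x ∈ cube n S := by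
    constructor
    · rintro ⟨y, hy, rfl⟩; simpa using hy
    · intro h; exact ⟨_, h, by simp⟩
  rw [this]
  simp only [cube, cyl, height, Set.mem_ofPred_eq, Fin.forall_fin_succ']

theorem mem_cyl_of_norm_sub_le {R : Space n ≃ₗᵢ[ℝ] Space n} {S S' m : ℝ} {x y : Space n}
    (hx : x ∈ cyl R S) (hxy : ‖x - y‖ ≤ m) (h : S + 2 * m ≤ S') : y ∈ cyl R S' := by
  intro k
  have h1 := hx k
  have h2 := abs_le.1 ((abs_coord_le R (x - y) k.castSucc).trans hxy)
  simp only [map_sub, PiLp.sub_apply] at h2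
  constructor <;> linarith [h1.1, h1.2, h2.1, h2.2]

theorem mem_slabBox_of_norm_sub_le {R : Space n ≃ₗᵢ[ℝ] Space n} {S S' a b a' b' m : ℝ}
    {x y : Space n} (hx : x ∈ slabBox R S a b) (hxy : ‖x - y‖ ≤ m) (h : S + 2 * m ≤ S')
    (ha : a' ≤ a - m) (hb : b + m ≤ b') : y ∈ slabBox R S' a' b' := by
  have h2 := abs_le.1 ((abs_height_le R (x - y)).trans hxy)
  rw [height_sub] at h2
  refine ⟨mem_cyl_of_norm_sub_le hx.1 hxy h, ?_, ?_⟩ <;> linarith [hx.2.1, hx.2.2]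

/-! ### Volumes of slabs and the tiling by lattice cells. -/

theorem volume_slabBox (R : Space n ≃ₗᵢ[ℝ] Space n) (S a b : ℝ) :
    volume (slabBox R S a b) = ENNReal.ofReal S ^ n * ENNReal.ofReal (b - a) := by
  let lo : Fin (n + 1) → ℝ := Fin.snoc (α := fun _ => ℝ) (fun _ => -(S / 2)) a
  let hi : Fin (n + 1) → ℝ := Fin.snoc (α := fun _ => ℝ) (fun _ => S / 2) b
  have h1 : slabBox R S a b = R.symm ⁻¹' ((@WithLp.ofLp 2 (Fin (n + 1) → ℝ)) ⁻¹'
      (Set.univ.pi fun i => Set.Ico (lo i) (hi i))) := by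
    ext x
    simp only [slabBox, cyl, height, Set.mem_ofPred_eq, Set.mem_preimage, Set.mem_pi, Set.mem_univ,
      true_implies, Set.mem_Ico]
    rw [Fin.forall_fin_succ']
    simp [lo, hi]
  have hm : MeasurableSet (Set.univ.pi fun i => Set.Ico (lo i) (hi i)) :=
    MeasurableSet.univ_pi fun i => measurableSet_Ico
  rw [h1, R.symm.measurePreserving.measure_preimage
    ((PiLp.volume_preserving_ofLp _).measurable hm).nullMeasurableSet,
    (PiLp.volume_preserving_ofLp _).measure_preimage hm.nullMeasurableSet,
    Real.volume_pi_Ico, Fin.prod_univ_castSucc]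
  simp [lo, hi]

theorem measurableSet_slabBox (R : Space n ≃ₗᵢ[ℝ] Space n) (S a b : ℝ) :
    MeasurableSet (slabBox R S a b) := by
  have hc : ∀ k, Measurable fun x : Space n => R.symm x k := fun k =>
    ((EuclideanSpace.proj (𝕜 := ℝ) k).continuous.comp R.symm.continuous).measurable
  have : slabBox R S a b = (⋂ k : Fin n, {x | -(S / 2) ≤ R.symm x k.castSucc ∧
      R.symm x k.castSucc < S / 2}) ∩ {x | a ≤ height R x ∧ height R x < b} := by
    ext x; simp [slabBox, cyl]
  rw [this]
  refine (MeasurableSet.iInter fun k => ?_).inter ?_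
  · exact (measurableSet_le measurable_const (hc _)).inter
      (measurableSet_lt (hc _) measurable_const)
  · exact (measurableSet_le measurable_const (hc _)).inter
      (measurableSet_lt (hc _) measurable_const)

theorem cube_eq_slabBox (n : ℕ) (S : ℝ) :
    cube n S = slabBox (LinearIsometryEquiv.refl ℝ (Space n)) S (-(S / 2)) (S / 2) := by
  ext x
  simp [cube, slabBox, cyl, height, Fin.forall_fin_succ']
  exact Iff.rfl

theorem volume_cube (n T : ℕ) : volume (cube n T) = ENNReal.ofReal ((T : ℝ) ^ (n + 1)) := by
  rw [cube_eq_slabBox, volume_slabBox, ENNReal.ofReal_pow (by positivity), pow_succ]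
  congr 2; ring

theorem measurableSet_cube (n : ℕ) (S : ℝ) : MeasurableSet (cube n S) := by
  rw [cube_eq_slabBox]; exact measurableSet_slabBox _ _ _ _

theorem exists_sub_shift_mem_cube {T : ℕ} (hT : 0 < T) (x : Space n) :
    ∃ z : Idx n, x - shift T z ∈ cube n T := by
  have hT' : (0 : ℝ) < T := by exact_mod_cast hT
  refine ⟨fun k => ⌊x k / T + 1 / 2⌋, fun k => ?_⟩
  have h1 := Int.floor_le (x k / T + 1 / 2)
  have h2 := Int.lt_floor_add_one (x k / T + 1 / 2)
  have h3 : x k = T * (x k / T) := by field_simp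
  simp only [PiLp.sub_apply, shift_apply]
  constructor <;> nlinarith

theorem eq_of_sub_shift_mem_cube {T : ℕ} (hT : 0 < T) {x : Space n} {z w : Idx n}
    (hz : x - shift T z ∈ cube n T) (hw : x - shift T w ∈ cube n T) : z = w := by
  have hT' : (0 : ℝ) < T := by exact_mod_cast hT
  funext k
  have h1 := hz k
  have h2 := hw k
  simp only [PiLp.sub_apply, shift_apply] at h1 h2
  have h3 : ((z k - w k : ℤ) : ℝ) < 1 := by
    push_cast
    by_contra hc
    nlinarith [h1.1, h1.2, h2.1, h2.2]
  have h4 : (-1 : ℝ) < ((z k - w k : ℤ) : ℝ) := by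
    push_cast
    by_contra hc
    nlinarith [h1.1, h1.2, h2.1, h2.2]
  have h5 : z k - w k < 1 := by exact_mod_cast h3
  have h6 : -1 < z k - w k := by exact_mod_cast h4
  omega

theorem exists_norm_le_of_mem_cube (n T : ℕ) : ∃ D : ℝ, 0 < D ∧ ∀ x ∈ cube n T, ‖x‖ ≤ D := by
  refine ⟨Real.sqrt (n + 1) * T + 1, by positivity, fun x hx => ?_⟩
  have : ‖x‖ ^ 2 ≤ (Real.sqrt (n + 1) * T) ^ 2 := by
    rw [EuclideanSpace.norm_sq_eq, mul_pow, Real.sq_sqrt (by positivity)]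
    calc ∑ i, ‖x i‖ ^ 2 ≤ ∑ i : Fin (n + 1), (T : ℝ) ^ 2 := by
          refine Finset.sum_le_sum fun k _ => ?_
          have := hx k
          have hT0 : (0 : ℝ) ≤ T := by positivity
          rw [Real.norm_eq_abs, sq_abs]
          nlinarith [this.1, this.2]
      _ = _ := by simp
  have := abs_le_of_sq_le_sq' this (by positivity)
  linarith [this.2]

/-- The lattice cell of index `z`. -/
def latticeCell (n T : ℕ) (z : Idx n) : Set (Space n) := {x | x - shift T z ∈ cube n T}

theorem volume_latticeCell (n T : ℕ) (z : Idx n) :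
    volume (latticeCell n T z) = ENNReal.ofReal ((T : ℝ) ^ (n + 1)) := by
  rw [← volume_cube]
  have : latticeCell n T z = (fun x => x + (-shift T z)) ⁻¹' cube n T := by
    ext x; simp [latticeCell, sub_eq_add_neg]
  rw [this, measure_preimage_add_right]

theorem measurableSet_latticeCell (n T : ℕ) (z : Idx n) :
    MeasurableSet (latticeCell n T z) :=
  (measurable_id.sub_const (shift T z)) (measurableSet_cube n T)

theorem volume_iUnion_latticeCell {T : ℕ} (hT : 0 < T) (A : Set (Idx n)) :
    volume (⋃ z ∈ A, latticeCell n T z) =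
      Measure.count A * ENNReal.ofReal ((T : ℝ) ^ (n + 1)) := by
  rw [measure_biUnion A.to_countable]
  · simp only [volume_latticeCell]
    rw [ENNReal.tsum_const, Measure.count_apply A.to_countable.measurableSet]
    rfl
  · intro z _ w _ hzw
    refine Set.disjoint_left.2 fun x hx hy => hzw (eq_of_sub_shift_mem_cube hT hx hy)
  · exact fun z _ => measurableSet_latticeCell n T z

/-! ### Counting lattice points by volume. -/

/-- The cells indexed by `A` are disjoint and lie in `B`. In the companion bound
`volume_le_count_mul` they cover `B`. -/
theorem count_mul_le_volume {T : ℕ} (hT : 0 < T) {A : Set (Idx n)} {B : Set (Space n)}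
    (h : ∀ z ∈ A, ∀ x, x - shift T z ∈ cube n T → x ∈ B) :
    Measure.count A * ENNReal.ofReal ((T : ℝ) ^ (n + 1)) ≤ volume B := by
  rw [← volume_iUnion_latticeCell hT]
  exact measure_mono (Set.iUnion₂_subset fun z hz x hx => h z hz x hx)

theorem volume_le_count_mul {T : ℕ} (hT : 0 < T) {A : Set (Idx n)} {B : Set (Space n)}
    (h : ∀ z, ∀ x ∈ B, x - shift T z ∈ cube n T → z ∈ A) :
    volume B ≤ Measure.count A * ENNReal.ofReal ((T : ℝ) ^ (n + 1)) := by
  rw [← volume_iUnion_latticeCell hT]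
  refine measure_mono fun x hx => ?_
  obtain ⟨z, hz⟩ := exists_sub_shift_mem_cube hT x
  exact Set.mem_iUnion₂.2 ⟨z, h z x hx hz, hz⟩

/-- A cell around a counted point stays within distance `D` of it, hence in the slab box thickened
by `D` on every side. -/
theorem count_slabSet_le {T : ℕ} (hT : 0 < T) {D : ℝ} (hD0 : 0 < D)
    (hD : ∀ x ∈ cube n T, ‖x‖ ≤ D) (R : Space n ≃ₗᵢ[ℝ] Space n) {S a b : ℝ} (hS : 0 ≤ S)
    (x : Space n) :
    Measure.count (slabSet R T S x a b) ≤
      ENNReal.ofReal ((S + 2 * D) ^ n * (b - a + 2 * D) / (T : ℝ) ^ (n + 1)) := by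
  have hT' : (0 : ℝ) < T := by exact_mod_cast hT
  rw [ENNReal.ofReal_div_of_pos (by positivity), ENNReal.le_div_iff_mul_le
    (Or.inl (by simp; positivity)) (Or.inl ENNReal.ofReal_ne_top)]
  refine (count_mul_le_volume hT (B := (fun y => x + y) ⁻¹' slabBox R (S + 2 * D)
    (a + height R x - D) (b + height R x + D)) ?_).trans ?_
  · intro z hz y hy
    refine mem_slabBox_of_norm_sub_le (S := S) (a := a + height R x) (b := b + height R x)
      (m := D) (x := x + shift T z) ⟨hz.1, ?_, ?_⟩ ?_ le_rfl le_rfl le_rfl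
    · rw [height_add]; linarith [hz.2.1]
    · rw [height_add]; linarith [hz.2.2]
    · have := hD _ hy
      rw [norm_sub_rev]
      simpa using this
  · rw [measure_preimage_add, volume_slabBox, ← ENNReal.ofReal_pow (by positivity),
      ← ENNReal.ofReal_mul (by positivity)]
    exact (congrArg ENNReal.ofReal (by ring)).le

theorem le_count_slabSet {T : ℕ} (hT : 0 < T) {D : ℝ}
    (hD : ∀ x ∈ cube n T, ‖x‖ ≤ D) (R : Space n ≃ₗᵢ[ℝ] Space n) {S a b : ℝ} (hS : 2 * D ≤ S)
    (x : Space n) :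
    ENNReal.ofReal ((S - 2 * D) ^ n * (b - a - 2 * D) / (T : ℝ) ^ (n + 1)) ≤
      Measure.count (slabSet R T S x a b) := by
  have hT' : (0 : ℝ) < T := by exact_mod_cast hT
  have hS' : 0 ≤ S - 2 * D := by linarith
  rw [ENNReal.ofReal_div_of_pos (by positivity)]
  refine ENNReal.div_le_of_le_mul ?_
  refine le_trans ?_ (volume_le_count_mul hT (B := (fun y => x + y) ⁻¹' slabBox R (S - 2 * D)
    (a + height R x + D) (b + height R x - D)) ?_)
  · rw [measure_preimage_add, volume_slabBox, ← ENNReal.ofReal_pow hS',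
      ← ENNReal.ofReal_mul (by positivity)]
    exact (congrArg ENNReal.ofReal (by ring)).le
  · intro z y hy hz
    have := mem_slabBox_of_norm_sub_le (S' := S) (a' := a + height R x) (b' := b + height R x)
      (m := D) (y := x + shift T z) hy (by simpa using hD _ hz) (by linarith) (by linarith)
      (by linarith)
    refine ⟨this.1, ?_, ?_⟩
    · have := this.2.1; rw [height_add] at this; linarith
    · have := this.2.2; rw [height_add] at this; linarith

/-- The constant is uniform in frame, base point and slab; the `+ 1` takes care of slabs thinner
than a cell. This is the source of the domination in the later limits. -/
theorem exists_count_slabSet_le (n : ℕ) {T : ℕ} (hT : 0 < T) :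
    ∃ C : ℝ, 0 < C ∧ ∀ (R : Space n ≃ₗᵢ[ℝ] Space n) (S a b : ℝ) (x : Space n), 1 ≤ S → a ≤ b →
      Measure.count (slabSet R T S x a b) ≤ ENNReal.ofReal (C * S ^ n * (b - a + 1)) := by
  obtain ⟨D, hD0, hD⟩ := exists_norm_le_of_mem_cube n T
  have hT' : (0 : ℝ) < T := by exact_mod_cast hT
  refine ⟨(1 + 2 * D) ^ n * (1 + 2 * D) / (T : ℝ) ^ (n + 1), by positivity,
    fun R S a b x hS hab => (count_slabSet_le hT hD0 hD R (by linarith) x).trans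
      (ENNReal.ofReal_le_ofReal ?_)⟩
  have h1 : (S + 2 * D) ^ n ≤ (1 + 2 * D) ^ n * S ^ n := by
    rw [← mul_pow]
    exact pow_le_pow_left₀ (by linarith) (by nlinarith) n
  have h2 : b - a + 2 * D ≤ (1 + 2 * D) * (b - a + 1) := by nlinarith
  calc (S + 2 * D) ^ n * (b - a + 2 * D) / (T : ℝ) ^ (n + 1)
      ≤ ((1 + 2 * D) ^ n * S ^ n) * ((1 + 2 * D) * (b - a + 1)) / (T : ℝ) ^ (n + 1) := by
        gcongr
    _ = _ := by ring

theorem exists_count_cube_le (n : ℕ) {T : ℕ} (hT : 0 < T) :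
    ∃ C : ℝ, 0 < C ∧ ∀ (R : Space n ≃ₗᵢ[ℝ] Space n) (S : ℝ) (x : Space n), 1 ≤ S →
      Measure.count {z : Idx n | x + shift T z ∈ R '' cube n S} ≤
        ENNReal.ofReal (C * S ^ n * S) := by
  obtain ⟨C, hC, h⟩ := exists_count_slabSet_le n hT
  refine ⟨2 * C, by positivity, fun R S x hS => ?_⟩
  refine (measure_mono ?_).trans ((h R S (-(S / 2) - height R x) (S / 2 - height R x) x hS
    (by linarith)).trans (ENNReal.ofReal_le_ofReal ?_))
  · intro z hz
    have := mem_image_cube.1 hz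
    rw [height_add] at this
    exact ⟨this.1, by linarith [this.2.1], by linarith [this.2.2]⟩
  · have : 0 < C * S ^ n := by positivity
    nlinarith

/-! ### Slab counts do not depend on the base point in the limit. -/

theorem tendsto_add_pow_div_pow (n : ℕ) (α : ℝ) :
    Tendsto (fun S : ℝ => (S + α) ^ n / S ^ n) atTop (𝓝 1) := by
  have h1 : Tendsto (fun S : ℝ => 1 + α / S) atTop (𝓝 1) := by
    simpa using (tendsto_const_nhds (x := (1 : ℝ))).add
      ((tendsto_const_nhds (x := α)).div_atTop (tendsto_id (α := ℝ)))
  have h2 := h1.pow n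
  rw [one_pow] at h2
  refine h2.congr' ?_
  filter_upwards [eventually_gt_atTop 0] with S hS
  rw [← div_pow, add_div, div_self hS.ne']

theorem ofReal_div_ofReal_pow {S : ℝ} (hS : 0 < S) (n : ℕ) (x : ℝ) :
    ENNReal.ofReal x / ENNReal.ofReal (S ^ n) = ENNReal.ofReal (x / S ^ n) :=
  (ENNReal.ofReal_div_of_pos (by positivity)).symm

/-- The cells of the exceptional points lie in the shell between the cylinders of sides `S + 2D` and
`S - 2m - 2D`, over a bounded range of heights. The volume of this shell is `o(S^n)`. -/
theorem tendsto_count_slabSet_diff {T : ℕ} (hT : 0 < T) (R : Space n ≃ₗᵢ[ℝ] Space n)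
    (x y : Space n) (a b : ℝ) :
    Tendsto (fun S : ℝ => Measure.count {z ∈ slabSet R T S x a b | y + shift T z ∉ cyl R S} /
      ENNReal.ofReal (S ^ n)) atTop (𝓝 0) := by
  obtain ⟨D, hD0, hD⟩ := exists_norm_le_of_mem_cube n T
  have hT' : (0 : ℝ) < T := by exact_mod_cast hT
  set m := ‖x - y‖ with hm
  have hm0 : 0 ≤ m := norm_nonneg _
  set lim : ℝ → ℝ := fun S => ((S + 2 * D) ^ n / S ^ n - (S + -(2 * m + 2 * D)) ^ n / S ^ n) *
    (b - a + 2 * D) / (T : ℝ) ^ (n + 1) with hlim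
  have h0 : Tendsto (fun S => ENNReal.ofReal (lim S)) atTop (𝓝 0) := by
    have : Tendsto lim atTop (𝓝 ((1 - 1) * (b - a + 2 * D) / (T : ℝ) ^ (n + 1))) :=
      (((tendsto_add_pow_div_pow n _).sub (tendsto_add_pow_div_pow n _)).mul_const _).div_const _
    simpa using ENNReal.tendsto_ofReal this
  refine tendsto_of_tendsto_of_tendsto_of_le_of_le' tendsto_const_nhds h0
    (Eventually.of_forall fun _ => zero_le) ?_
  filter_upwards [eventually_gt_atTop 0, eventually_ge_atTop (2 * m + 2 * D)] with S hS hS'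
  have hlim' : lim S = ((S + 2 * D) ^ n - (S - 2 * m - 2 * D) ^ n) * (b - a + 2 * D) /
      (T : ℝ) ^ (n + 1) / S ^ n := by
    simp only [hlim]; rw [show S + -(2 * m + 2 * D) = S - 2 * m - 2 * D by ring]; field_simp
  rw [hlim', ← ofReal_div_ofReal_pow hS]
  gcongr
  rw [ENNReal.ofReal_div_of_pos (by positivity), ENNReal.le_div_iff_mul_le
    (Or.inl (by simp; positivity)) (Or.inl ENNReal.ofReal_ne_top)]
  set a' := a + height R x - D
  set b' := b + height R x + D
  refine (count_mul_le_volume hT (B := (fun y => x + y) ⁻¹' (slabBox R (S + 2 * D) a' b' \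
    slabBox R (S - 2 * m - 2 * D) a' b')) ?_).trans ?_
  · rintro z ⟨hz, hy⟩ p hp
    have hnorm : ‖x + shift T z - (x + p)‖ ≤ D := by
      rw [norm_sub_rev]; simpa using hD _ hp
    refine ⟨mem_slabBox_of_norm_sub_le (S := S) (a := a + height R x) (b := b + height R x)
      (m := D) (x := x + shift T z) ⟨hz.1, ?_, ?_⟩ hnorm le_rfl le_rfl le_rfl, fun hp' => hy ?_⟩
    · rw [height_add]; linarith [hz.2.1]
    · rw [height_add]; linarith [hz.2.2]
    · refine mem_cyl_of_norm_sub_le (m := m + D) hp'.1 ?_ (by linarith)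
      calc ‖x + p - (y + shift T z)‖ = ‖(x - y) + (p - shift T z)‖ := by congr 1; abel
        _ ≤ m + D := (norm_add_le _ _).trans (add_le_add le_rfl (hD _ hp))
  · rw [measure_preimage_add, measure_sdiff _ (measurableSet_slabBox _ _ _ _).nullMeasurableSet,
      volume_slabBox, volume_slabBox, ← ENNReal.ofReal_pow (by positivity),
      ← ENNReal.ofReal_pow (by linarith), ← ENNReal.sub_mul, ← ENNReal.ofReal_sub,
      ← ENNReal.ofReal_mul]
    · exact (congrArg ENNReal.ofReal (by simp only [a', b']; ring)).le
    · exact sub_nonneg.2 (pow_le_pow_left₀ (by linarith) (by linarith) n)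
    · exact pow_nonneg (by linarith) n
    · intros; exact ENNReal.ofReal_ne_top
    · rw [volume_slabBox]; exact ENNReal.mul_ne_top (ENNReal.pow_ne_top ENNReal.ofReal_ne_top)
        ENNReal.ofReal_ne_top
    · exact fun p hp =>
        ⟨mem_cyl_of_norm_sub_le (m := 0) (x := p) hp.1 (by simp) (by linarith), hp.2⟩

theorem count_slabSet_ne_top {T : ℕ} (hT : 0 < T) (R : Space n ≃ₗᵢ[ℝ] Space n) {S : ℝ}
    (hS : 0 ≤ S) (x : Space n) (a b : ℝ) : Measure.count (slabSet R T S x a b) ≠ ⊤ := by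
  obtain ⟨D, hD0, hD⟩ := exists_norm_le_of_mem_cube n T
  exact ((count_slabSet_le hT hD0 hD R hS x).trans_lt ENNReal.ofReal_lt_top).ne

/-! ### The limit distribution of lattice heights. -/

/-- The number of lattice points in a slab of the cylinder, per unit of cross section. -/
def slabDensity (R : Space n ≃ₗᵢ[ℝ] Space n) (T : ℕ) (x : Space n) (a b S : ℝ) : ℝ :=
  (Measure.count (slabSet R T S x a b)).toReal / S ^ n

theorem slabDensity_add {T : ℕ} (hT : 0 < T) (R : Space n ≃ₗᵢ[ℝ] Space n) {S : ℝ} (hS : 0 ≤ S)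
    (x : Space n) {a b d : ℝ} (hab : a ≤ b) (hbd : b ≤ d) :
    slabDensity R T x a d S = slabDensity R T x a b S + slabDensity R T x b d S := by
  have h1 : slabSet R T S x a d = slabSet R T S x a b ∪ slabSet R T S x b d := by
    ext z
    simp only [slabSet, Set.mem_ofPred_eq, Set.mem_union]
    constructor
    · rintro ⟨h, h1, h2⟩
      rcases lt_or_ge (height R (shift T z)) b with h3 | h3
      · exact Or.inl ⟨h, h1, h3⟩
      · exact Or.inr ⟨h, h3, h2⟩
    · rintro (⟨h, h1, h2⟩ | ⟨h, h1, h2⟩)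
      · exact ⟨h, h1, h2.trans_le hbd⟩
      · exact ⟨h, hab.trans h1, h2⟩
  have h2 : Disjoint (slabSet R T S x a b) (slabSet R T S x b d) :=
    Set.disjoint_left.2 fun z h h' => absurd h.2.2 (not_lt.2 h'.2.1)
  rw [slabDensity, h1, measure_union h2 (Set.to_countable _).measurableSet,
    ENNReal.toReal_add (count_slabSet_ne_top hT R hS _ _ _) (count_slabSet_ne_top hT R hS _ _ _),
    add_div]
  rfl

theorem slabDensity_translate (R : Space n ≃ₗᵢ[ℝ] Space n) (T : ℕ) (x : Space n) (a b S : ℝ)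
    (e : Idx n) :
    slabDensity R T x (a + height R (shift T e)) (b + height R (shift T e)) S =
      slabDensity R T (x + shift T e) a b S := by
  have : slabSet R T S x (a + height R (shift T e)) (b + height R (shift T e)) =
      (fun z => z + e) '' slabSet R T S (x + shift T e) a b := by
    ext z
    constructor
    · rintro ⟨h1, h2, h3⟩
      refine ⟨z - e, ⟨?_, ?_, ?_⟩, by simp⟩
      · rw [sub_eq_add_neg, shift_add, shift_neg]; convert h1 using 1; abel
      · rw [sub_eq_add_neg, shift_add, shift_neg, height_add, height_neg]; linarith
      · rw [sub_eq_add_neg, shift_add, shift_neg, height_add, height_neg]; linarith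
    · rintro ⟨w, ⟨h1, h2, h3⟩, rfl⟩
      refine ⟨?_, ?_, ?_⟩
      · rw [shift_add]; convert h1 using 1; abel
      · simp only [shift_add, height_add]; linarith
      · simp only [shift_add, height_add]; linarith
  rw [slabDensity, this, Measure.count_injective_image (add_left_injective e)]
  rfl

theorem tendsto_slabDensity_sub {T : ℕ} (hT : 0 < T) (R : Space n ≃ₗᵢ[ℝ] Space n)
    (x y : Space n) (a b : ℝ) :
    Tendsto (fun S => slabDensity R T x a b S - slabDensity R T y a b S) atTop (𝓝 0) := by
  have key : ∀ x y : Space n, ∀ᶠ S : ℝ in atTop, slabDensity R T x a b S - slabDensity R T y a b S ≤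
      (Measure.count {z ∈ slabSet R T S x a b | y + shift T z ∉ cyl R S} /
        ENNReal.ofReal (S ^ n)).toReal := by
    intro x y
    filter_upwards [eventually_gt_atTop 0] with S hS
    have hy := count_slabSet_ne_top hT R hS.le y a b
    have hx : Measure.count {z ∈ slabSet R T S x a b | y + shift T z ∉ cyl R S} ≠ ⊤ :=
      ((measure_mono (fun z hz => hz.1)).trans_lt
        (count_slabSet_ne_top hT R hS.le x a b).lt_top).ne
    rw [ENNReal.toReal_div, ENNReal.toReal_ofReal (by positivity), slabDensity, slabDensity,
      ← sub_div]
    gcongr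
    rw [sub_le_iff_le_add', ← ENNReal.toReal_add hy hx]
    refine ENNReal.toReal_mono (ENNReal.add_ne_top.2 ⟨hy, hx⟩)
      ((measure_mono ?_).trans (measure_union_le _ _))
    intro z hz
    by_cases h : y + shift T z ∈ cyl R S
    · exact Or.inl ⟨h, hz.2⟩
    · exact Or.inr ⟨hz, h⟩
  have lim : ∀ x y : Space n, Tendsto (fun S : ℝ => (Measure.count
      {z ∈ slabSet R T S x a b | y + shift T z ∉ cyl R S} / ENNReal.ofReal (S ^ n)).toReal)
      atTop (𝓝 0) := fun x y =>
    (ENNReal.tendsto_toReal ENNReal.zero_ne_top).comp (tendsto_count_slabSet_diff hT R x y a b)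
  have hneg := (lim y x).neg
  rw [neg_zero] at hneg
  refine tendsto_of_tendsto_of_tendsto_of_le_of_le' hneg (lim x y) ?_ (key x y)
  filter_upwards [key y x] with S hS
  linarith

/-- The error `C` does not depend on the thickness of the slab. It is useless for one thin slab but
negligible for a thick one, relative to its thickness. -/
theorem eventually_abs_slabDensity_sub_le {T : ℕ} (hT : 0 < T) (R : Space n ≃ₗᵢ[ℝ] Space n)
    (x : Space n) : ∃ C : ℝ, 0 < C ∧ ∀ a b : ℝ, a ≤ b → ∀ᶠ S : ℝ in atTop,
      |slabDensity R T x a b S - (b - a) / (T : ℝ) ^ (n + 1)| ≤ C := by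
  obtain ⟨D, hD0, hD⟩ := exists_norm_le_of_mem_cube n T
  have hT' : (0 : ℝ) < (T : ℝ) ^ (n + 1) := pow_pos (by exact_mod_cast hT) _
  refine ⟨(2 * D) / (T : ℝ) ^ (n + 1) + 1, by positivity, fun a b hab => ?_⟩
  have l1 : Tendsto (fun S : ℝ => (S + 2 * D) ^ n / S ^ n * ((b - a + 2 * D) / (T : ℝ) ^ (n + 1)))
      atTop (𝓝 (1 * ((b - a + 2 * D) / (T : ℝ) ^ (n + 1)))) :=
    (tendsto_add_pow_div_pow n _).mul_const _
  have l2 : Tendsto (fun S : ℝ => (S + -(2 * D)) ^ n / S ^ n *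
      ((b - a - 2 * D) / (T : ℝ) ^ (n + 1)))
      atTop (𝓝 (1 * ((b - a - 2 * D) / (T : ℝ) ^ (n + 1)))) :=
    (tendsto_add_pow_div_pow n _).mul_const _
  filter_upwards [eventually_gt_atTop 0, eventually_ge_atTop (2 * D),
    l1.eventually_lt_const (lt_add_one _), l2.eventually_const_lt (sub_one_lt _)] with S h0 hS h1 h2
  have u1 := ENNReal.toReal_mono ENNReal.ofReal_ne_top
    (count_slabSet_le (a := a) (b := b) hT hD0 hD R h0.le x)
  rw [ENNReal.toReal_ofReal (div_nonneg (mul_nonneg (by positivity) (by linarith)) hT'.le)] at u1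
  have u2 := ENNReal.toReal_mono (count_slabSet_ne_top hT R h0.le x a b)
    (le_count_slabSet (a := a) (b := b) hT hD R hS x)
  -- The lower volume bound may be negative for a thin slab, where `ENNReal.ofReal` truncates it to
  -- `0`.
  have u3 := (le_max_left _ (0 : ℝ)).trans (ENNReal.toReal_ofReal'.symm.le.trans u2)
  have hSn : 0 < S ^ n := by positivity
  have v1 : slabDensity R T x a b S ≤ (S + 2 * D) ^ n / S ^ n *
      ((b - a + 2 * D) / (T : ℝ) ^ (n + 1)) := by
    refine (div_le_div_of_nonneg_right u1 hSn.le).trans (le_of_eq ?_)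
    field_simp
  have v2 : (S + -(2 * D)) ^ n / S ^ n * ((b - a - 2 * D) / (T : ℝ) ^ (n + 1)) ≤
      slabDensity R T x a b S := by
    refine (le_of_eq ?_).trans (div_le_div_of_nonneg_right u3 hSn.le)
    rw [← sub_eq_add_neg]
    field_simp
  have e1 : (b - a + 2 * D) / (T : ℝ) ^ (n + 1) =
    (b - a) / (T : ℝ) ^ (n + 1) + 2 * D / (T : ℝ) ^ (n + 1) := add_div _ _ _
  have e2 : (b - a - 2 * D) / (T : ℝ) ^ (n + 1) =
    (b - a) / (T : ℝ) ^ (n + 1) - 2 * D / (T : ℝ) ^ (n + 1) := sub_div _ _ _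
  rw [abs_le]
  constructor <;> linarith

theorem shift_nsmul (T k : ℕ) (e : Idx n) : shift T (k • e) = (k : ℝ) • shift T e := by
  ext i; simp [shift_apply]; ring

theorem height_smul (R : Space n ≃ₗᵢ[ℝ] Space n) (t : ℝ) (x : Space n) :
    height R (t • x) = t * height R x := by simp [height]

/-- A slab of thickness `k * s` consists of `k` lattice translates of the slab of thickness `s`, all
of asymptotically equal density. The thick slab has density `k * s / T^(n+1)` up to a bounded error,
and division by a large `k` makes this error smaller than any `ε`. -/
theorem tendsto_slabDensity_lattice {T : ℕ} (hT : 0 < T) (R : Space n ≃ₗᵢ[ℝ] Space n)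
    (x : Space n) (a : ℝ) (e : Idx n) (he : 0 ≤ height R (shift T e)) :
    Tendsto (slabDensity R T x a (a + height R (shift T e))) atTop
      (𝓝 (height R (shift T e) / (T : ℝ) ^ (n + 1))) := by
  set s := height R (shift T e) with hs
  have htel : ∀ k : ℕ, Tendsto (fun S => slabDensity R T x a (a + k * s) S -
      k * slabDensity R T x a (a + s) S) atTop (𝓝 0) := by
    intro k
    induction k with
    | zero =>
      have : ∀ S, slabSet R T S x a a = ∅ := fun S =>
        Set.eq_empty_of_forall_notMem fun z hz => absurd hz.2.2 (not_lt.2 hz.2.1)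
      simp [slabDensity, this]
    | succ k ih =>
      have hk : height R (shift T (k • e)) = k * s := by rw [shift_nsmul, height_smul]
      have h2 := tendsto_slabDensity_sub hT R (x + shift T (k • e)) x a (a + s)
      have h3 := ih.add h2
      rw [add_zero] at h3
      refine h3.congr' ?_
      filter_upwards [eventually_ge_atTop 0] with S hS
      have hks : 0 ≤ k * s := by positivity
      rw [slabDensity_add hT R hS x (a := a) (b := a + k * s) (d := a + (k + 1 : ℕ) * s)
        (by linarith) (by push_cast; linarith), ← slabDensity_translate, hk]
      rw [show a + (k + 1 : ℕ) * s = a + s + k * s by push_cast; ring]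
      push_cast; ring
  obtain ⟨C, hC, hbd⟩ := eventually_abs_slabDensity_sub_le hT R x
  rw [Metric.tendsto_nhds]
  intro ε hε
  obtain ⟨k, hk⟩ := exists_nat_gt ((C + 1) / ε)
  have hk0 : (0 : ℝ) < k := lt_trans (by positivity) hk
  have h1 := hbd a (a + k * s) (by have : 0 ≤ k * s := by positivity
                                   linarith)
  have h2 := (Metric.tendsto_nhds.1 (htel k)) 1 one_pos
  filter_upwards [h1, h2] with S h1 h2
  rw [Real.dist_eq, sub_zero] at h2
  rw [Real.dist_eq]
  rw [div_lt_iff₀ hε] at hk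
  have h3 : |k * slabDensity R T x a (a + s) S - k * s / (T : ℝ) ^ (n + 1)| < C + 1 := by
    rw [show a + k * s - a = k * s by ring] at h1
    rw [abs_lt] at h2 ⊢
    rw [abs_le] at h1
    constructor <;> linarith [h1.1, h1.2, h2.1, h2.2]
  rw [mul_div_assoc, ← mul_sub, abs_mul, abs_of_pos hk0] at h3
  exact lt_of_mul_lt_mul_left (h3.trans hk) hk0.le

theorem slabDensity_mono {T : ℕ} (hT : 0 < T) (R : Space n ≃ₗᵢ[ℝ] Space n) {S : ℝ} (hS : 0 ≤ S)
    (x : Space n) (a : ℝ) {b b' : ℝ} (h : b ≤ b') :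
    slabDensity R T x a b S ≤ slabDensity R T x a b' S :=
  div_le_div_of_nonneg_right (ENNReal.toReal_mono (count_slabSet_ne_top hT R hS _ _ _)
    (measure_mono fun _ hz => ⟨hz.1, hz.2.1, hz.2.2.trans_le h⟩)) (by positivity)

theorem exists_height_shift_pos {T : ℕ} (hT : 0 < T) (R : Space n ≃ₗᵢ[ℝ] Space n) :
    ∃ e : Idx n, 0 < height R (shift T e) := by
  obtain ⟨D, hD0, hD⟩ := exists_norm_le_of_mem_cube n T
  -- A lattice vector within distance `D` of a point at height `D + 1` has height at least `1`.
  obtain ⟨z, hz⟩ := exists_sub_shift_mem_cube hT ((D + 1) • R (lastBasisVector n))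
  refine ⟨z, ?_⟩
  have h1 := (abs_le.1 ((abs_height_le R _).trans (hD _ hz))).2
  rw [height_sub, height_smul] at h1
  have h2 : height R (R (lastBasisVector n)) = 1 := by simp [height, lastBasisVector]
  rw [h2] at h1
  linarith

/-- The subgroup of heights of the lattice vectors. -/
def heightGroup (R : Space n ≃ₗᵢ[ℝ] Space n) (T : ℕ) : AddSubgroup ℝ where
  carrier := Set.range fun e : Idx n => height R (shift T e)
  add_mem' := by
    rintro _ _ ⟨e, rfl⟩ ⟨f, rfl⟩
    exact ⟨e + f, by simp [shift_add, height_add]⟩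
  zero_mem' := ⟨0, by simp [shift_zero, height]⟩
  neg_mem' := by
    rintro _ ⟨e, rfl⟩
    exact ⟨-e, by simp [shift_neg, height_neg]⟩

/-- The limit distribution function of the heights of the lattice points in large cylinders. -/
theorem exists_limit_distribution {T : ℕ} (hT : 0 < T) (R : Space n ≃ₗᵢ[ℝ] Space n) :
    ∃ G : ℝ → ℝ, Monotone G ∧
      (∀ (t : ℝ) (e : Idx n), G (t + height R (shift T e)) =
        G t + height R (shift T e) / (T : ℝ) ^ (n + 1)) ∧
      ∀ (x : Space n) (a b : ℝ), Tendsto (fun S : ℝ => Measure.count (slabSet R T S x a b) /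
        ENNReal.ofReal (S ^ n)) atTop (𝓝 (ENNReal.ofReal (G b - G a))) := by
  have hT' : (0 : ℝ) < (T : ℝ) ^ (n + 1) := pow_pos (by exact_mod_cast hT) _
  suffices h : ∃ G : ℝ → ℝ, Monotone G ∧
      (∀ (t : ℝ) (e : Idx n), G (t + height R (shift T e)) =
        G t + height R (shift T e) / (T : ℝ) ^ (n + 1)) ∧
      ∀ (x : Space n) (a b : ℝ), a < b →
        Tendsto (slabDensity R T x a b) atTop (𝓝 (G b - G a)) by
    obtain ⟨G, hG, hper, hlim⟩ := h
    refine ⟨G, hG, hper, fun x a b => ?_⟩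
    rcases lt_or_ge a b with hab | hab
    · refine (ENNReal.tendsto_ofReal (hlim x a b hab)).congr' ?_
      filter_upwards [eventually_gt_atTop 0] with S hS
      rw [slabDensity, ENNReal.ofReal_div_of_pos (by positivity),
        ENNReal.ofReal_toReal (count_slabSet_ne_top hT R hS.le _ _ _)]
    · have : ∀ S, slabSet R T S x a b = ∅ := fun S =>
        Set.eq_empty_of_forall_notMem fun z hz => absurd (hz.2.2.trans_le hab) (not_lt.2 hz.2.1)
      rw [ENNReal.ofReal_of_nonpos (sub_nonpos.2 (hG hab))]
      simp [this]
  rcases (heightGroup R T).dense_or_cyclic with hd | ⟨h', hc⟩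
  -- Dense heights: any thickness is squeezed between heights of lattice vectors, for which the
  -- density is already known.
  · refine ⟨fun t => t / (T : ℝ) ^ (n + 1), fun t t' h => by simp only; gcongr,
      fun t e => add_div _ _ _, fun x a b hab => ?_⟩
    rw [tendsto_order]
    constructor
    · intro y hy
      -- The maximum with `0` forces the approximating lattice height to be positive.
      have : max 0 (y * (T : ℝ) ^ (n + 1)) < b - a := by
        rw [max_lt_iff, ← lt_div_iff₀ hT', sub_div]
        exact ⟨by linarith, hy⟩
      obtain ⟨_, ⟨e, rfl⟩, h1, h2⟩ := hd.exists_between this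
      simp only at h1 h2
      rw [max_lt_iff] at h1
      have h3 := tendsto_slabDensity_lattice hT R x a e h1.1.le
      filter_upwards [h3.eventually_const_lt ((lt_div_iff₀ hT').2 h1.2), eventually_ge_atTop 0]
        with S hS h0
      exact hS.trans_le (slabDensity_mono hT R h0 x a (by linarith))
    · intro y hy
      have : b - a < y * (T : ℝ) ^ (n + 1) := by
        rwa [← div_lt_iff₀ hT', sub_div]
      obtain ⟨_, ⟨e, rfl⟩, h1, h2⟩ := hd.exists_between this
      simp only at h1 h2
      have h3 := tendsto_slabDensity_lattice hT R x a e (by linarith)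
      filter_upwards [h3.eventually_lt_const ((div_lt_iff₀ hT').2 h2), eventually_ge_atTop 0]
        with S hS h0
      exact (slabDensity_mono hT R h0 x a (by linarith)).trans_lt hS
  · obtain ⟨e₀, he₀⟩ := exists_height_shift_pos hT R
    have hmem : ∀ t, t ∈ heightGroup R T ↔ ∃ m : ℤ, t = m * |h'| := by
      intro t
      rw [hc, AddSubgroup.mem_closure_singleton]
      simp only [zsmul_eq_mul]
      rcases abs_choice h' with h | h <;> rw [h]
      · exact ⟨fun ⟨m, hm⟩ => ⟨m, hm.symm⟩, fun ⟨m, hm⟩ => ⟨m, hm.symm⟩⟩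
      · exact ⟨fun ⟨m, hm⟩ => ⟨-m, by rw [← hm]; push_cast; ring⟩,
          fun ⟨m, hm⟩ => ⟨-m, by rw [hm]; push_cast; ring⟩⟩
    have hh : 0 < |h'| := by
      obtain ⟨m, hm⟩ := (hmem _).1 ⟨e₀, rfl⟩
      rcases (abs_nonneg h').eq_or_lt with h | h
      · simp only [← h, mul_zero] at hm
        exact absurd hm he₀.ne'
      · exact h
    set h := |h'|
    -- Cyclic heights: only multiples of `h` occur, so an endpoint can be replaced by the first
    -- multiple not below it. The ceiling is right because slabs are closed below and open above.
    refine ⟨fun t => h * ⌈t / h⌉ / (T : ℝ) ^ (n + 1), fun t t' htt' => ?_, fun t e => ?_,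
      fun x a b hab => ?_⟩
    · simp only; gcongr
    · obtain ⟨m, hm⟩ := (hmem _).1 ⟨e, rfl⟩
      simp only at hm ⊢
      rw [hm, show (t + m * h) / h = t / h + m by field_simp, Int.ceil_add_intCast]
      push_cast; ring
    · obtain ⟨e, he⟩ := (hmem (((⌈b / h⌉ - ⌈a / h⌉ : ℤ) : ℝ) * h)).2 ⟨_, rfl⟩
      simp only at he
      have hset : ∀ S, slabSet R T S x a b =
          slabSet R T S x (h * ⌈a / h⌉) (h * ⌈a / h⌉ + height R (shift T e)) := by
        intro S
        ext z
        obtain ⟨m, hm⟩ := (hmem _).1 ⟨z, rfl⟩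
        simp only at hm
        have key : ∀ t : ℝ, t ≤ m * h ↔ h * ⌈t / h⌉ ≤ m * h := by
          intro t
          rw [← div_le_iff₀ hh, ← Int.ceil_le, mul_comm h, mul_le_mul_iff_left₀ hh, Int.cast_le]
        have e1 : h * ⌈a / h⌉ + height R (shift T e) = h * ⌈b / h⌉ := by
          rw [he]; push_cast; ring
        simp only [slabSet, Set.mem_ofPred_eq, hm, e1, ← not_le]
        rw [key a, key b]
      have he0 : 0 ≤ height R (shift T e) := by
        rw [he]
        have : ⌈a / h⌉ ≤ ⌈b / h⌉ := Int.ceil_mono (by gcongr)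
        have : (0 : ℝ) ≤ ((⌈b / h⌉ - ⌈a / h⌉ : ℤ) : ℝ) := by exact_mod_cast sub_nonneg.2 this
        positivity
      have := tendsto_slabDensity_lattice hT R x (h * ⌈a / h⌉) e he0
      have e2 : h * ⌈b / h⌉ / (T : ℝ) ^ (n + 1) - h * ⌈a / h⌉ / (T : ℝ) ^ (n + 1) =
          height R (shift T e) / (T : ℝ) ^ (n + 1) := by rw [he]; push_cast; ring
      rw [e2]
      refine this.congr fun S => ?_
      rw [slabDensity, slabDensity, ← hset]

/-! ### Sites modulo the lattice; the energy as a sum over pairs. -/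

/-- The translate of the site `x` by `T z`. -/
def translate {T : ℕ} {L : Set (Space n)} (hL : PeriodicSet T L) (x : L) (z : Idx n) : L :=
  ⟨x + shift T z, (hL z).subset ⟨x, x.2, rfl⟩⟩

@[simp]
theorem coe_translate {T : ℕ} {L : Set (Space n)} (hL : PeriodicSet T L) (x : L) (z : Idx n) :
    (translate hL x z : Space n) = x + shift T z := rfl

theorem translate_translate {T : ℕ} {L : Set (Space n)} (hL : PeriodicSet T L) (x : L)
    (z w : Idx n) : translate hL (translate hL x z) w = translate hL x (z + w) := by
  apply Subtype.ext
  simp [shift_add, add_assoc]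

/-- The sites in the periodicity cell. -/
abbrev Base (T : ℕ) (L : Set (Space n)) : Type := {i : L // (i : Space n) ∈ cube n T}

/-- Every site is the translate of a unique site of the periodicity cell. -/
def baseProdEquiv {T : ℕ} (hT : 0 < T) {L : Set (Space n)} (hL : PeriodicSet T L) :
    Base T L × Idx n ≃ L :=
  Equiv.ofBijective (fun p => translate hL p.1 p.2) <| by
    constructor
    · rintro ⟨i, z⟩ ⟨j, w⟩ h
      have h' : ((i : L) : Space n) + shift T z = (j : L) + shift T w := congrArg Subtype.val h
      have hzw : z = w := by
        refine eq_of_sub_shift_mem_cube hT (x := ((i : L) : Space n) + shift T z) ?_ ?_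
        · simpa using i.2
        · rw [h']; simpa using j.2
      subst hzw
      have : i = j := Subtype.ext (Subtype.ext (add_right_cancel h'))
      rw [this]
    · intro x
      obtain ⟨z, hz⟩ := exists_sub_shift_mem_cube hT (x : Space n)
      refine ⟨(⟨translate hL x (-z), ?_⟩, z), ?_⟩
      · simpa [shift_neg, ← sub_eq_add_neg] using hz
      · simp only [translate_translate]
        apply Subtype.ext
        simp [shift_zero]

theorem baseProdEquiv_apply {T : ℕ} (hT : 0 < T) {L : Set (Space n)} (hL : PeriodicSet T L)
    (i : Base T L) (z : Idx n) : baseProdEquiv hT hL (i, z) = translate hL i z := rfl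

theorem coeff_translate {T : ℕ} {L : Set (Space n)} (hL : PeriodicSet T L) {c : L → L → ℝ≥0}
    (hc : PeriodicCoeff T c) (i j : L) (z : Idx n) :
    c (translate hL i z) (translate hL j z) = c i j :=
  hc z i j _ _ rfl rfl

/-- The bijection of the set of sites given by translation. -/
def translateEquiv {T : ℕ} {L : Set (Space n)} (hL : PeriodicSet T L) (z : Idx n) : L ≃ L where
  toFun x := translate hL x z
  invFun x := translate hL x (-z)
  left_inv x := by
    simp only [translate_translate]; apply Subtype.ext; simp [shift_zero]
  right_inv x := by
    simp only [translate_translate]; apply Subtype.ext; simp [shift_zero]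

/-- The contribution to the energy in `A` of all translates of the ordered pair `(i, j)`, without
the coefficient. -/
def pairEnergy {T : ℕ} {L : Set (Space n)} (hL : PeriodicSet T L) (u : L → ℝ) (A : Set (Space n))
    (i j : L) : ℝ≥0∞ :=
  ∑' z : Idx n, {z : Idx n | (i : Space n) + shift T z ∈ A}.indicator
    (fun z => ENNReal.ofReal (u (translate hL i z) - u (translate hL j z))) z

/-- Tonelli: write each first site as a base site plus `Tz` and move the second site by the same
vector. By (H1) the coefficient does not see `z`. -/
theorem energy_eq_tsum {T : ℕ} (hT : 0 < T) {L : Set (Space n)} (hL : PeriodicSet T L)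
    {c : L → L → ℝ≥0} (hc : PeriodicCoeff T c) (u : L → ℝ) (A : Set (Space n)) :
    energy c u A = ∑' i : Base T L, ∑' j : L, (c i j : ℝ≥0∞) * pairEnergy hL u A i j := by
  have h1 : energy c u A = ∑' i : L, {i : L | (i : Space n) ∈ A}.indicator
      (fun i => ∑' j : L, (c i j : ℝ≥0∞) * ENNReal.ofReal (u i - u j)) i :=
    tsum_subtype {i : L | (i : Space n) ∈ A}
      (fun i : L => ∑' j : L, (c i j : ℝ≥0∞) * ENNReal.ofReal (u i - u j))
  rw [h1, ← (baseProdEquiv hT hL).tsum_eq, ENNReal.tsum_prod']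
  refine tsum_congr fun i => ?_
  simp_rw [pairEnergy, baseProdEquiv_apply, ← ENNReal.tsum_mul_left]
  rw [ENNReal.tsum_comm]
  refine tsum_congr fun z => ?_
  by_cases h : ((i : L) : Space n) + shift T z ∈ A
  · rw [Set.indicator_of_mem (by exact h), ← (translateEquiv hL z).tsum_eq]
    refine tsum_congr fun j => ?_
    rw [Set.indicator_of_mem (by exact h)]
    change (c (translate hL i z) (translate hL j z) : ℝ≥0∞) * _ = _
    rw [coeff_translate hL hc]
    rfl
  · rw [Set.indicator_of_notMem (by exact h)]
    simp [h]

theorem energy_cube_eq (T : ℕ) {L : Set (Space n)} (c : L → L → ℝ≥0) (u : L → ℝ) :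
    energy c u (cube n T) =
      ∑' i : Base T L, ∑' j : L, (c i j : ℝ≥0∞) * ENNReal.ofReal (u i - u j) := rfl

/-! ### Finiteness, summability and dominated convergence. -/

theorem finite_base (T : ℕ) {L : Set (Space n)} (hL : UniformlyDiscrete L) :
    Finite (Base T L) := by
  obtain ⟨r, hr, hsep⟩ := hL
  obtain ⟨D, hD0, hD⟩ := exists_norm_le_of_mem_cube n T
  have htb : TotallyBounded (Metric.closedBall (0 : Space n) D) :=
    (isCompact_closedBall _ _).totallyBounded
  obtain ⟨t, ht, hcov⟩ := Metric.totallyBounded_iff.1 htb (r / 2) (by positivity)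
  have hex : ∀ i : Base T L, ∃ y : t, dist ((i : L) : Space n) y < r / 2 := by
    intro i
    have := hcov (show ((i : L) : Space n) ∈ Metric.closedBall 0 D by simpa using hD _ i.2)
    obtain ⟨y, hy, h⟩ := Set.mem_iUnion₂.1 this
    exact ⟨⟨y, hy⟩, h⟩
  choose f hf using hex
  have := ht.to_subtype
  refine Finite.of_injective f fun i j hij => ?_
  by_contra hne
  have h1 := hsep _ (i : L).2 _ (j : L).2 fun h => hne (Subtype.ext (Subtype.ext h))
  have h2 := hf i
  have h3 := hf j
  rw [← hij] at h3
  have := dist_triangle_right ((i : L) : Space n) (j : L) (f i : Space n)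
  linarith

theorem countable_sites {T : ℕ} (hT : 0 < T) {L : Set (Space n)} (hL : UniformlyDiscrete L)
    (hP : PeriodicSet T L) : Countable L := by
  have := finite_base T hL
  exact (baseProdEquiv hT hP).symm.injective.countable

/-- Off the diagonal `|i - j| ≥ r`, so `1 + |i - j|` is at most `(1 + r⁻¹) |i - j|` and (H2) makes
the majorant summable. The majorant vanishes on the diagonal, so there `t` has to vanish too. -/
theorem exists_coeff_bound (T : ℕ) {L : Set (Space n)} (hL : UniformlyDiscrete L)
    {c : L → L → ℝ≥0} (hc : DecayCoeff c) {C : ℝ} (hC : 0 ≤ C) :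
    ∃ B : Base T L × L → ℝ≥0∞, ∑' p, B p ≠ ⊤ ∧
      ∀ (i : Base T L) (j : L) (t : ℝ≥0∞),
        t ≤ ENNReal.ofReal (C * (1 + ‖((i : L) : Space n) - j‖)) → (j = i → t = 0) →
        (c i j : ℝ≥0∞) * t ≤ B (i, j) := by
  have hfin := finite_base T hL
  obtain ⟨r, hr, hsep⟩ := hL
  refine ⟨fun p => ENNReal.ofReal ((c p.1 p.2 : ℝ) * ‖((p.1 : L) : Space n) - p.2‖ *
    (C * (1 + r⁻¹))), ?_, fun i j t ht h0 => ?_⟩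
  · rw [ENNReal.tsum_prod']
    have := Fintype.ofFinite (Base T L)
    rw [tsum_fintype]
    exact ENNReal.sum_ne_top.2 fun i _ => ((hc i).mul_right _).tsum_ofReal_ne_top
  · by_cases hij : j = i
    · simp [h0 hij]
    · have h1 : r ≤ ‖((i : L) : Space n) - j‖ := by
        rw [← dist_eq_norm]
        exact hsep _ (i : L).2 _ j.2 fun h => hij (Subtype.ext h.symm)
      have h2 : 1 ≤ r⁻¹ * ‖((i : L) : Space n) - j‖ := by
        rw [inv_mul_eq_div, one_le_div hr]; exact h1
      calc (c i j : ℝ≥0∞) * t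
          ≤ (c i j : ℝ≥0∞) * ENNReal.ofReal (‖((i : L) : Space n) - j‖ * (C * (1 + r⁻¹))) := by
            gcongr
            refine ht.trans (ENNReal.ofReal_le_ofReal ?_)
            nlinarith
        _ = _ := by
            simp only
            rw [mul_assoc, ENNReal.ofReal_mul (NNReal.coe_nonneg _), ENNReal.ofReal_coe_nnreal]

theorem tsum_coeff_mul_ne_top {T : ℕ} {L : Set (Space n)} (hL : UniformlyDiscrete L)
    {c : L → L → ℝ≥0} (hc : DecayCoeff c) {C : ℝ} (hC : 0 ≤ C) {F : Base T L → L → ℝ≥0∞}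
    (hF : ∀ i j, F i j ≤ ENNReal.ofReal (C * (1 + ‖((i : L) : Space n) - j‖)))
    (h0 : ∀ i : Base T L, F i i = 0) :
    ∑' i : Base T L, ∑' j : L, (c i j : ℝ≥0∞) * F i j ≠ ⊤ := by
  obtain ⟨B, hB, hle⟩ := exists_coeff_bound T hL hc hC
  rw [← ENNReal.tsum_prod]
  refine ne_top_of_le_ne_top hB (ENNReal.tsum_le_tsum fun p => ?_)
  refine hle p.1 p.2 _ (hF _ _) ?_
  rintro h
  rw [h, h0]

/-- Dominated convergence for the double sums weighted by the coefficients. -/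
theorem tendsto_tsum_coeff_mul {T : ℕ} {L : Set (Space n)} (hL : UniformlyDiscrete L)
    {c : L → L → ℝ≥0} (hc : DecayCoeff c) {C : ℝ} (hC : 0 ≤ C)
    {f : ℝ → Base T L → L → ℝ≥0∞} {F : Base T L → L → ℝ≥0∞}
    (hf : ∀ᶠ S : ℝ in atTop, ∀ i j,
      f S i j ≤ ENNReal.ofReal (C * S ^ n * (1 + ‖((i : L) : Space n) - j‖)))
    (h0 : ∀ᶠ S : ℝ in atTop, ∀ i : Base T L, f S i i = 0)
    (hlim : ∀ i j, Tendsto (fun S => f S i j / ENNReal.ofReal (S ^ n)) atTop (𝓝 (F i j))) :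
    Tendsto (fun S => (∑' i : Base T L, ∑' j : L, (c i j : ℝ≥0∞) * f S i j) /
      ENNReal.ofReal (S ^ n)) atTop (𝓝 (∑' i : Base T L, ∑' j : L, (c i j : ℝ≥0∞) * F i j)) := by
  obtain ⟨B, hB, hle⟩ := exists_coeff_bound T hL hc hC
  -- The double series is an integral for the counting measure; the discrete σ-algebra makes
  -- measurability automatic.
  let _ : MeasurableSpace (Base T L × L) := ⊤
  have h1 : ∀ S : ℝ, (∑' i : Base T L, ∑' j : L, (c i j : ℝ≥0∞) * f S i j) / ENNReal.ofReal (S ^ n)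
      = ∫⁻ p : Base T L × L, (c p.1 p.2 : ℝ≥0∞) * (f S p.1 p.2 / ENNReal.ofReal (S ^ n))
        ∂Measure.count := by
    intro S
    rw [lintegral_count, ENNReal.tsum_prod', div_eq_mul_inv, ← ENNReal.tsum_mul_right]
    refine tsum_congr fun i => ?_
    rw [← ENNReal.tsum_mul_right]
    exact tsum_congr fun j => by rw [mul_assoc, div_eq_mul_inv]
  have h2 : ∑' i : Base T L, ∑' j : L, (c i j : ℝ≥0∞) * F i j =
      ∫⁻ p : Base T L × L, (c p.1 p.2 : ℝ≥0∞) * F p.1 p.2 ∂Measure.count := by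
    rw [lintegral_count, ENNReal.tsum_prod']
  simp_rw [h1]
  rw [h2]
  refine tendsto_lintegral_filter_of_dominated_convergence B
    (Eventually.of_forall fun S => measurable_from_top) ?_ (by rwa [lintegral_count]) ?_
  · filter_upwards [hf, h0, eventually_gt_atTop 0] with S hS h0 hS0
    refine Eventually.of_forall fun p => hle p.1 p.2 _ ?_ ?_
    · refine ENNReal.div_le_of_le_mul ?_
      rw [← ENNReal.ofReal_mul (by positivity)]
      refine (hS p.1 p.2).trans (ENNReal.ofReal_le_ofReal (le_of_eq (by ring)))
    · intro h
      rw [h, h0, ENNReal.zero_div]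
  · exact Eventually.of_forall fun p =>
      ENNReal.Tendsto.const_mul (hlim p.1 p.2) (Or.inr ENNReal.coe_ne_top)

/-! ### Limit distributions and counts in cubes. -/

/-- `G` is a limit distribution function of the heights of lattice points in large cylinders. -/
structure IsLimitDistribution (R : Space n ≃ₗᵢ[ℝ] Space n) (T : ℕ) (G : ℝ → ℝ) : Prop where
  mono : Monotone G
  add_height : ∀ (t : ℝ) (e : Idx n), G (t + height R (shift T e)) =
    G t + height R (shift T e) / (T : ℝ) ^ (n + 1)
  tendsto : ∀ (x : Space n) (a b : ℝ), Tendsto (fun S : ℝ =>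
    Measure.count (slabSet R T S x a b) / ENNReal.ofReal (S ^ n)) atTop
      (𝓝 (ENNReal.ofReal (G b - G a)))

theorem exists_isLimitDistribution {T : ℕ} (hT : 0 < T) (R : Space n ≃ₗᵢ[ℝ] Space n) :
    ∃ G, IsLimitDistribution R T G := by
  obtain ⟨G, h1, h2, h3⟩ := exists_limit_distribution hT R
  exact ⟨G, h1, h2, h3⟩

theorem tendsto_scale {f : ℝ → ℝ≥0∞} {l : ℝ≥0∞} {n : ℕ}
    (h : Tendsto (fun S => f S / ENNReal.ofReal (S ^ n)) atTop (𝓝 l)) {θ : ℝ} (hθ : 0 < θ) :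
    Tendsto (fun S => f (θ * S) / ENNReal.ofReal (S ^ n)) atTop
      (𝓝 (ENNReal.ofReal (θ ^ n) * l)) := by
  have h1 := ENNReal.Tendsto.const_mul (a := ENNReal.ofReal (θ ^ n))
    (h.comp (tendsto_id.const_mul_atTop hθ)) (Or.inr ENNReal.ofReal_ne_top)
  refine h1.congr' ?_
  filter_upwards [eventually_gt_atTop 0] with S hS
  simp only [Function.comp, id]
  have hθn : ENNReal.ofReal (θ ^ n) ≠ 0 := by simp; positivity
  rw [mul_pow, ENNReal.ofReal_mul (by positivity), div_eq_mul_inv, div_eq_mul_inv,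
    ENNReal.mul_inv (Or.inl hθn) (Or.inl ENNReal.ofReal_ne_top), mul_left_comm,
    ← mul_assoc (ENNReal.ofReal (θ ^ n)), ENNReal.mul_inv_cancel hθn ENNReal.ofReal_ne_top, one_mul]

/-- For bounded slabs, cubes and cylinders of large size contain the same translates. -/
theorem eventually_mem_cube_iff (R : Space n ≃ₗᵢ[ℝ] Space n) (T : ℕ) (x : Space n) (a b : ℝ) :
    ∀ᶠ S : ℝ in atTop, ∀ z : Idx n, a ≤ height R (shift T z) → height R (shift T z) < b →
      (x + shift T z ∈ R '' cube n S ↔ x + shift T z ∈ cyl R S) := by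
  filter_upwards [eventually_ge_atTop (2 * (|height R x| + |a| + |b|))] with S hS z h1 h2
  rw [mem_image_cube, height_add]
  have := abs_le.1 (le_refl |height R x|)
  have := abs_le.1 (le_refl |a|)
  have := abs_le.1 (le_refl |b|)
  have := abs_nonneg a
  have := abs_nonneg b
  constructor
  · exact fun h => h.1
  · exact fun h => ⟨h, by linarith, by linarith⟩

theorem IsLimitDistribution.tendsto_cube {R : Space n ≃ₗᵢ[ℝ] Space n} {T : ℕ} {G : ℝ → ℝ}
    (hG : IsLimitDistribution R T G) (x : Space n) (a b : ℝ) :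
    Tendsto (fun S : ℝ => Measure.count {z : Idx n | x + shift T z ∈ R '' cube n S ∧
      a ≤ height R (shift T z) ∧ height R (shift T z) < b} / ENNReal.ofReal (S ^ n)) atTop
      (𝓝 (ENNReal.ofReal (G b - G a))) := by
  refine (hG.tendsto x a b).congr' ?_
  filter_upwards [eventually_mem_cube_iff R T x a b] with S hS
  congr 2
  ext z
  constructor
  · rintro ⟨h1, h2, h3⟩; exact ⟨(hS z h2 h3).2 h1, h2, h3⟩
  · rintro ⟨h1, h2, h3⟩; exact ⟨(hS z h2 h3).1 h1, h2, h3⟩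

theorem tendsto_count_cube_diff {T : ℕ} (hT : 0 < T) (R : Space n ≃ₗᵢ[ℝ] Space n)
    (x y : Space n) (a b : ℝ) :
    Tendsto (fun S : ℝ => Measure.count {z : Idx n | x + shift T z ∈ R '' cube n S ∧
      y + shift T z ∉ R '' cube n S ∧ a ≤ height R (shift T z) ∧ height R (shift T z) < b} /
        ENNReal.ofReal (S ^ n)) atTop (𝓝 0) := by
  refine tendsto_of_tendsto_of_tendsto_of_le_of_le' tendsto_const_nhds
    (tendsto_count_slabSet_diff hT R x y a b) (Eventually.of_forall fun _ => zero_le) ?_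
  filter_upwards [eventually_mem_cube_iff R T y a b] with S hS
  refine ENNReal.div_le_div_right (measure_mono ?_) _
  rintro z ⟨h1, h2, h3, h4⟩
  exact ⟨⟨(mem_image_cube.1 h1).1, h3, h4⟩, fun h => h2 ((hS z h3 h4).2 h)⟩

/-! ### Superlevel sets of equivariant functions. -/

/-- The indicator function of the superlevel set `{v ≥ t}`. -/
def levelSpin {L : Set (Space n)} (v : L → ℝ) (t : ℝ) (x : L) : ℝ :=
  open Classical in if t ≤ v x then 1 else 0

/-- `v` grows by the height of the translation vector under translations in the lattice. -/
def IsEquivariant {T : ℕ} {L : Set (Space n)} (hL : PeriodicSet T L)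
    (R : Space n ≃ₗᵢ[ℝ] Space n) (v : L → ℝ) : Prop :=
  ∀ (x : L) (z : Idx n), v (translate hL x z) = v x + height R (shift T z)

theorem isEquivariant_height {T : ℕ} {L : Set (Space n)} (hL : PeriodicSet T L)
    (R : Space n ≃ₗᵢ[ℝ] Space n) : IsEquivariant hL R (fun x : L => height R x) := fun x z => by
  simp [height_add]

/-- The difference `v - height` is lattice periodic, so it only takes its values on the finite set
of base sites. -/
theorem IsEquivariant.exists_abs_sub_le {T : ℕ} (hT : 0 < T) {L : Set (Space n)}
    (hL : UniformlyDiscrete L) {hP : PeriodicSet T L} {R : Space n ≃ₗᵢ[ℝ] Space n} {v : L → ℝ}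
    (hv : IsEquivariant hP R v) : ∃ P : ℝ, 0 ≤ P ∧ ∀ x : L, |v x - height R x| ≤ P := by
  have := finite_base T hL
  have := Fintype.ofFinite (Base T L)
  refine ⟨∑ i : Base T L, |v i - height R (i : L)|, Finset.sum_nonneg fun _ _ => abs_nonneg _,
    fun x => ?_⟩
  obtain ⟨⟨i, z⟩, rfl⟩ := (baseProdEquiv hT hP).surjective x
  rw [baseProdEquiv_apply, hv, coe_translate, height_add, add_sub_add_right_eq_sub]
  exact Finset.single_le_sum (f := fun i : Base T L => |v i - height R (i : L)|)
    (fun _ _ => abs_nonneg _) (Finset.mem_univ i)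

theorem pairEnergy_self {T : ℕ} {L : Set (Space n)} (hL : PeriodicSet T L) (u : L → ℝ)
    (A : Set (Space n)) (i : L) : pairEnergy hL u A i i = 0 := by
  simp [pairEnergy]

theorem tsum_indicator_one (A : Set (Idx n)) :
    ∑' z, A.indicator (fun _ => (1 : ℝ≥0∞)) z = Measure.count A := by
  rw [← lintegral_count, lintegral_indicator A.to_countable.measurableSet]
  simp

theorem ofReal_levelSpin_sub {L : Set (Space n)} (v : L → ℝ) (t : ℝ) (x y : L) :
    ENNReal.ofReal (levelSpin v t x - levelSpin v t y) =
      open Classical in if t ≤ v x ∧ v y < t then 1 else 0 := by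
  by_cases h1 : t ≤ v x <;> by_cases h2 : t ≤ v y <;> simp [levelSpin, h1, h2]

/-- The translate by `Tz` contributes `1` exactly when `v j + height (Tz) < t ≤ v i + height (Tz)`,
and `0` otherwise. -/
theorem pairEnergy_levelSpin {T : ℕ} {L : Set (Space n)} {hL : PeriodicSet T L}
    {R : Space n ≃ₗᵢ[ℝ] Space n} {v : L → ℝ} (hv : IsEquivariant hL R v) (t : ℝ)
    (A : Set (Space n)) (i j : L) :
    pairEnergy hL (levelSpin v t) A i j = Measure.count {z : Idx n | (i : Space n) + shift T z ∈ A ∧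
      t - v i ≤ height R (shift T z) ∧ height R (shift T z) < t - v j} := by
  rw [← tsum_indicator_one, pairEnergy]
  refine tsum_congr fun z => ?_
  classical
  simp only [Set.indicator_apply, Set.mem_ofPred_eq]
  by_cases h : (i : Space n) + shift T z ∈ A
  · simp only [h, if_true, true_and]
    rw [ofReal_levelSpin_sub, hv, hv]
    refine if_congr ?_ rfl rfl
    exact and_congr sub_le_iff_le_add'.symm lt_sub_iff_add_lt'.symm
  · simp [h]

/-- The energy per unit area of the interface of the superlevel set `{v ≥ t}`. -/
def levelDensity {L : Set (Space n)} (T : ℕ) (c : L → L → ℝ≥0) (G : ℝ → ℝ) (v : L → ℝ)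
    (t : ℝ) : ℝ≥0∞ :=
  ∑' i : Base T L, ∑' j : L, (c i j : ℝ≥0∞) * ENNReal.ofReal (G (t - v j) - G (t - v i))

/-- Each pair count converges to an increment of `G`. Since `v` is within `P` of the height, the
relevant slab has thickness at most `2P + |i - j|`, which gives the domination. -/
theorem tendsto_energy_levelSpin {T : ℕ} (hT : 0 < T) {L : Set (Space n)}
    (hL : UniformlyDiscrete L) {hP : PeriodicSet T L} {c : L → L → ℝ≥0} (hc : PeriodicCoeff T c)
    (hd : DecayCoeff c) {R : Space n ≃ₗᵢ[ℝ] Space n} {G : ℝ → ℝ}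
    (hG : IsLimitDistribution R T G) {v : L → ℝ} (hv : IsEquivariant hP R v) (t : ℝ) :
    Tendsto (fun S : ℝ => energy c (levelSpin v t) (R '' cube n S) / ENNReal.ofReal (S ^ n)) atTop
      (𝓝 (levelDensity T c G v t)) ∧ levelDensity T c G v t ≠ ⊤ := by
  obtain ⟨P, hP0, hPv⟩ := hv.exists_abs_sub_le hT hL
  obtain ⟨C, hC, hcount⟩ := exists_count_slabSet_le n hT
  have hbd : ∀ᶠ S : ℝ in atTop, ∀ (i : Base T L) (j : L),
      pairEnergy hP (levelSpin v t) (R '' cube n S) i j ≤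
        ENNReal.ofReal (C * (2 * P + 1) * S ^ n * (1 + ‖((i : L) : Space n) - j‖)) := by
    filter_upwards [eventually_ge_atTop 1] with S hS i j
    rw [pairEnergy_levelSpin hv]
    rcases lt_or_ge (t - v j) (t - v i) with h | h
    · have : {z : Idx n | ((i : L) : Space n) + shift T z ∈ R '' cube n S ∧
        t - v i ≤ height R (shift T z) ∧ height R (shift T z) < t - v j} = ∅ :=
        Set.eq_empty_of_forall_notMem fun z hz => by
          have := hz.2.1; have := hz.2.2; linarith
      rw [this, measure_empty]
      exact zero_le
    · refine (measure_mono (t := slabSet R T S i (t - v i) (t - v j))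
        fun z hz => ⟨(mem_image_cube.1 hz.1).1, hz.2⟩).trans
        ((hcount R S _ _ i hS h).trans (ENNReal.ofReal_le_ofReal ?_))
      have h1 := abs_le.1 (hPv i)
      have h2 := abs_le.1 (hPv j)
      have h3 := (abs_le.1 (abs_height_le R (((i : L) : Space n) - j))).2
      rw [height_sub] at h3
      have h4 : t - v j - (t - v i) + 1 ≤ (2 * P + 1) * (1 + ‖((i : L) : Space n) - j‖) := by
        nlinarith [norm_nonneg (((i : L) : Space n) - j)]
      calc C * S ^ n * (t - v j - (t - v i) + 1)
          ≤ C * S ^ n * ((2 * P + 1) * (1 + ‖((i : L) : Space n) - j‖)) := by gcongr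
        _ = _ := by ring
  have hlim : ∀ (i : Base T L) (j : L), Tendsto (fun S : ℝ =>
      pairEnergy hP (levelSpin v t) (R '' cube n S) i j / ENNReal.ofReal (S ^ n)) atTop
      (𝓝 (ENNReal.ofReal (G (t - v j) - G (t - v i)))) := by
    intro i j
    simp_rw [pairEnergy_levelSpin hv]
    exact hG.tendsto_cube _ _ _
  constructor
  · simp_rw [energy_eq_tsum hT hP hc]
    exact tendsto_tsum_coeff_mul hL hd (by positivity) hbd
      (Eventually.of_forall fun S i => pairEnergy_self _ _ _ _) hlim
  · refine tsum_coeff_mul_ne_top hL hd (C := C * (2 * P + 1)) (by positivity)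
      (fun i j => le_of_tendsto (hlim i j) ?_) (by simp)
    filter_upwards [hbd, eventually_gt_atTop 0] with S hS hS0
    refine ENNReal.div_le_of_le_mul ?_
    rw [← ENNReal.ofReal_mul (by positivity)]
    exact (hS i j).trans (ENNReal.ofReal_le_ofReal (le_of_eq (by ring)))

/-! ### Energy in the annulus between two cubes. -/

theorem energy_union {L : Set (Space n)} (c : L → L → ℝ≥0) (u : L → ℝ)
    {A B : Set (Space n)} (h : Disjoint A B) :
    energy c u (A ∪ B) = energy c u A + energy c u B := by
  have key : ∀ A : Set (Space n), energy c u A = ∑' i : L, {i : L | (i : Space n) ∈ A}.indicator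
      (fun i => ∑' j : L, (c i j : ℝ≥0∞) * ENNReal.ofReal (u i - u j)) i := fun A =>
    tsum_subtype {i : L | (i : Space n) ∈ A}
      (fun i : L => ∑' j : L, (c i j : ℝ≥0∞) * ENNReal.ofReal (u i - u j))
  rw [key, key, key, ← ENNReal.tsum_add]
  refine tsum_congr fun i => ?_
  classical
  simp only [Set.indicator_apply, Set.mem_ofPred_eq, Set.mem_union]
  by_cases hA : (i : Space n) ∈ A
  · simp [hA, Set.disjoint_left.1 h hA]
  · simp [hA]

theorem image_cube_mono (R : Space n ≃ₗᵢ[ℝ] Space n) {S S' : ℝ} (h : S ≤ S') :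
    R '' cube n S ⊆ R '' cube n S' := by
  refine Set.image_mono fun x hx k => ⟨?_, ?_⟩ <;> linarith [(hx k).1, (hx k).2]

theorem tendsto_energy_annulus {T : ℕ} (hT : 0 < T) {L : Set (Space n)}
    (hL : UniformlyDiscrete L) {hP : PeriodicSet T L} {c : L → L → ℝ≥0} (hc : PeriodicCoeff T c)
    (hd : DecayCoeff c) {R : Space n ≃ₗᵢ[ℝ] Space n} {G : ℝ → ℝ}
    (hG : IsLimitDistribution R T G) {v : L → ℝ} (hv : IsEquivariant hP R v) (t : ℝ)
    {θ : ℝ} (hθ0 : 0 < θ) (hθ1 : θ ≤ 1) :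
    Tendsto (fun S : ℝ => energy c (levelSpin v t) (R '' cube n S \ R '' cube n (θ * S)) /
      ENNReal.ofReal (S ^ n)) atTop (𝓝 (ENNReal.ofReal (1 - θ ^ n) * levelDensity T c G v t)) := by
  obtain ⟨h1, hfin⟩ := tendsto_energy_levelSpin hT hL hc hd hG hv t
  have h2 := tendsto_scale h1 hθ0
  have hfin2 : ENNReal.ofReal (θ ^ n) * levelDensity T c G v t ≠ ⊤ :=
    ENNReal.mul_ne_top ENNReal.ofReal_ne_top hfin
  have h3 := ENNReal.Tendsto.sub h1 h2 (Or.inl hfin)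
  have e : ENNReal.ofReal (1 - θ ^ n) * levelDensity T c G v t =
      levelDensity T c G v t - ENNReal.ofReal (θ ^ n) * levelDensity T c G v t := by
    rw [ENNReal.ofReal_sub _ (by positivity), ENNReal.sub_mul fun _ _ => hfin]
    simp
  rw [e]
  refine h3.congr' ?_
  filter_upwards [eventually_gt_atTop 0, h2.eventually_lt_const hfin2.lt_top] with S hS hlt
  have h4 : R '' cube n S = R '' cube n (θ * S) ∪ (R '' cube n S \ R '' cube n (θ * S)) :=
    (Set.union_sdiff_cancel (image_cube_mono R (by nlinarith))).symm
  have h5 : energy c (levelSpin v t) (R '' cube n S) / ENNReal.ofReal (S ^ n) =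
      energy c (levelSpin v t) (R '' cube n (θ * S)) / ENNReal.ofReal (S ^ n) +
      energy c (levelSpin v t) (R '' cube n S \ R '' cube n (θ * S)) / ENNReal.ofReal (S ^ n) := by
    conv_lhs => rw [h4]
    rw [energy_union _ _ Set.disjoint_sdiff_right, ENNReal.add_div]
  rw [h5, ENNReal.add_sub_cancel_left hlt.ne]

/-! ### The coarea formula over one period. -/

/-- `K t = G t - t / T^(n+1)` has period `s`, so its two shifts have the same integral over a period
and cancel. Only the linear part is left. -/
theorem IsLimitDistribution.integral_sub {T : ℕ} {R : Space n ≃ₗᵢ[ℝ] Space n} {G : ℝ → ℝ}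
    (hG : IsLimitDistribution R T G) (e : Idx n) (x y : ℝ) :
    ∫ t in (0 : ℝ)..height R (shift T e), (G (t - y) - G (t - x)) =
      height R (shift T e) * ((x - y) / (T : ℝ) ^ (n + 1)) := by
  set s := height R (shift T e) with hs
  set q := (T : ℝ) ^ (n + 1)
  set K : ℝ → ℝ := fun t => G t - t / q with hK
  have hper : Function.Periodic K s := by
    intro t
    simp only [hK]
    rw [hs, hG.add_height, ← hs]
    ring
  have hGi : ∀ a b : ℝ, IntervalIntegrable G volume a b := fun a b => hG.mono.intervalIntegrable
  have hKi : ∀ a b : ℝ, IntervalIntegrable K volume a b := fun a b =>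
    (hGi a b).sub ((continuous_id.div_const q).intervalIntegrable a b)
  have hshift : ∀ y : ℝ, ∫ t in (0 : ℝ)..s, K (t - y) = ∫ t in (0 : ℝ)..s, K t := by
    intro y
    rw [intervalIntegral.integral_comp_sub_right K y]
    have := hper.intervalIntegral_add_eq (0 - y) 0
    rw [zero_add, show 0 - y + s = s - y by ring] at this
    exact this
  have hKi' : ∀ y a b : ℝ, IntervalIntegrable (fun t => K (t - y)) volume a b := fun y a b => by
    have := (hKi (a - y) (b - y)).comp_sub_right y
    simpa using this
  have h1 : ∀ t : ℝ, G (t - y) - G (t - x) = (K (t - y) - K (t - x)) + (x - y) / q := by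
    intro t
    simp only [hK]; ring
  simp_rw [h1]
  rw [intervalIntegral.integral_add ((hKi' y 0 s).sub (hKi' x 0 s))
    intervalIntegrable_const, intervalIntegral.integral_sub (hKi' y 0 s) (hKi' x 0 s), hshift,
    hshift]
  rw [sub_self, zero_add, intervalIntegral.integral_const, sub_zero, smul_eq_mul]

/-- Coarea for a single pair: by monotonicity of `G` the integrand has the sign of `x - y` for all
`t`, so positive parts commute with the integral. -/
theorem IsLimitDistribution.lintegral_sub {T : ℕ} {R : Space n ≃ₗᵢ[ℝ] Space n} {G : ℝ → ℝ}
    (hG : IsLimitDistribution R T G) {e : Idx n} (he : 0 < height R (shift T e)) (x y : ℝ) :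
    ∫⁻ t in Set.Ioc 0 (height R (shift T e)), ENNReal.ofReal (G (t - y) - G (t - x)) =
      ENNReal.ofReal (height R (shift T e)) *
        (ENNReal.ofReal (x - y) / ENNReal.ofReal ((T : ℝ) ^ (n + 1))) := by
  rcases le_total y x with h | h
  · rw [← ofReal_integral_eq_lintegral_ofReal, ← intervalIntegral.integral_of_le he.le,
      hG.integral_sub, ENNReal.ofReal_mul he.le]
    · by_cases hT : T = 0
      · exfalso
        subst hT
        have : shift 0 e = (0 : Space n) := by ext k; simp [shift_apply]
        simp [this, height] at he
      · rw [ENNReal.ofReal_div_of_pos (by positivity)]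
    · have hm : ∀ y, IntervalIntegrable (fun t => G (t - y)) volume 0 (height R (shift T e)) :=
        fun y => Monotone.intervalIntegrable fun a b hab => hG.mono (by linarith)
      exact ((hm y).sub (hm x)).1
    · exact Eventually.of_forall fun t => sub_nonneg.2 (hG.mono (by linarith))
  · have : ∀ t, ENNReal.ofReal (G (t - y) - G (t - x)) = 0 := fun t =>
      ENNReal.ofReal_of_nonpos (sub_nonpos.2 (hG.mono (by linarith)))
    simp [this, ENNReal.ofReal_of_nonpos (sub_nonpos.2 h)]

/-- Summing the coarea identity over pairs, the right side is the mean of the level densities over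
`(0, s]`; some level does not exceed the mean. -/
theorem exists_levelDensity_le {T : ℕ} (hT : 0 < T) {L : Set (Space n)}
    (hL : UniformlyDiscrete L) (hP : PeriodicSet T L) (c : L → L → ℝ≥0)
    {R : Space n ≃ₗᵢ[ℝ] Space n} {G : ℝ → ℝ} (hG : IsLimitDistribution R T G) (v : L → ℝ) :
    ∃ t, levelDensity T c G v t ≤
      energy c v (cube n T) / ENNReal.ofReal ((T : ℝ) ^ (n + 1)) := by
  obtain ⟨e, he⟩ := exists_height_shift_pos hT R
  set s := height R (shift T e) with hs
  have := countable_sites hT hL hP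
  have hmeas : ∀ x y : ℝ, Measurable fun t : ℝ => ENNReal.ofReal (G (t - y) - G (t - x)) :=
    fun x y => ENNReal.measurable_ofReal.comp
      ((hG.mono.measurable.comp (measurable_id.sub_const y)).sub
        (hG.mono.measurable.comp (measurable_id.sub_const x)))
  have hμ : volume.restrict (Set.Ioc 0 s) ≠ 0 := by
    rw [Ne, Measure.restrict_eq_zero, Real.volume_Ioc]
    simpa using he
  have hmeas2 : Measurable fun t => levelDensity T c G v t :=
    Measurable.tsum fun i => Measurable.tsum fun j => (hmeas _ _).const_mul _
  obtain ⟨t, ht⟩ := exists_le_laverage hμ hmeas2.aemeasurable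
  refine ⟨t, ht.trans (le_of_eq ?_)⟩
  have hs0 : ENNReal.ofReal s ≠ 0 := by simpa using he
  have hint : ∫⁻ t in Set.Ioc 0 s, levelDensity T c G v t =
      ENNReal.ofReal s * (energy c v (cube n T) / ENNReal.ofReal ((T : ℝ) ^ (n + 1))) := by
    simp only [levelDensity]
    rw [lintegral_tsum fun i =>
      (Measurable.tsum fun j => (hmeas _ _).const_mul _).aemeasurable, energy_cube_eq,
      div_eq_mul_inv, ← ENNReal.tsum_mul_right, ← ENNReal.tsum_mul_left]
    refine tsum_congr fun i => ?_
    rw [lintegral_tsum fun j => ((hmeas _ _).const_mul _).aemeasurable,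
      ← ENNReal.tsum_mul_right, ← ENNReal.tsum_mul_left]
    refine tsum_congr fun j => ?_
    rw [lintegral_const_mul _ (hmeas _ _), hG.lintegral_sub he, div_eq_mul_inv, ← hs]
    ring
  rw [laverage_eq, hint, Measure.restrict_apply_univ, Real.volume_Ioc, sub_zero]
  rw [mul_comm, ENNReal.mul_div_cancel_right hs0 ENNReal.ofReal_ne_top]

/-! ### Upper bound by gluing a level set to the half space. -/

theorem halfSpaceSpin_eq_levelSpin {L : Set (Space n)} {R : Space n ≃ₗᵢ[ℝ] Space n} {ν : Space n}
    (hR : R (lastBasisVector n) = ν) (x : L) :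
    halfSpaceSpin ν x = levelSpin (fun x : L => height R x) 0 x := by
  simp [halfSpaceSpin, levelSpin, inner_eq_height hR]

theorem levelSpin_eq_zero_or_one {L : Set (Space n)} (v : L → ℝ) (t : ℝ) (x : L) :
    levelSpin v t x = 0 ∨ levelSpin v t x = 1 := by
  by_cases h : t ≤ v x <;> simp [levelSpin, h]

/-- Indices for which one site of the pair `(i, j)` lies in the cube and the other does not, the
second site being at bounded height. -/
def crossingSet (R : Space n ≃ₗᵢ[ℝ] Space n) (T : ℕ) (S a b : ℝ) (x y : Space n) :
    Set (Idx n) :=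
  {z | x + shift T z ∈ R '' cube n S ∧ y + shift T z ∉ R '' cube n S ∧
    a ≤ height R (shift T z) ∧ height R (shift T z) < b}

/-- For a fixed pair, crossings with `j` at height in `[a, b)` are `o(S^n)`; the slab bound, uniform
in the pair, dominates. -/
theorem tendsto_tsum_crossing {T : ℕ} (hT : 0 < T) {L : Set (Space n)}
    (hL : UniformlyDiscrete L) {c : L → L → ℝ≥0} (hd : DecayCoeff c)
    (R : Space n ≃ₗᵢ[ℝ] Space n) {a b : ℝ} (hab : a ≤ b) :
    Tendsto (fun S : ℝ => (∑' i : Base T L, ∑' j : L, (c i j : ℝ≥0∞) *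
      (Measure.count (crossingSet R T S (a - height R j) (b - height R j) (i : L) j) +
        Measure.count (crossingSet R T S (a - height R j) (b - height R j) j (i : L)))) /
        ENNReal.ofReal (S ^ n)) atTop (𝓝 0) := by
  obtain ⟨C, hC, hcount⟩ := exists_count_slabSet_le n hT
  have hba : 0 ≤ b - a := sub_nonneg.2 hab
  have hbd : ∀ S : ℝ, 1 ≤ S → ∀ h (x y : Space n),
      Measure.count (crossingSet R T S (a - h) (b - h) x y) ≤
        ENNReal.ofReal (C * S ^ n * (b - a + 1)) := by
    intro S hS h x y
    refine (measure_mono (t := slabSet R T S x (a - h) (b - h))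
      fun z hz => ⟨(mem_image_cube.1 hz.1).1, hz.2.2⟩).trans ((hcount R S _ _ x hS
        (by linarith)).trans (ENNReal.ofReal_le_ofReal (le_of_eq (by ring))))
  have := tendsto_tsum_coeff_mul (T := T) hL hd (C := 2 * (C * (b - a + 1)))
    (f := fun S i j =>
      Measure.count (crossingSet R T S (a - height R j) (b - height R j) (i : L) j) +
        Measure.count (crossingSet R T S (a - height R j) (b - height R j) j (i : L)))
    (F := fun _ _ => 0) (by positivity) ?_ ?_ ?_
  · simpa using this
  · filter_upwards [eventually_ge_atTop 1] with S hS i j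
    refine (add_le_add (hbd S hS _ _ _) (hbd S hS _ _ _)).trans ?_
    rw [← ENNReal.ofReal_add (by positivity) (by positivity)]
    refine ENNReal.ofReal_le_ofReal ?_
    have h1 : 0 ≤ C * S ^ n * (b - a + 1) := by positivity
    nlinarith [norm_nonneg (((i : L) : Space n) - j)]
  · refine Eventually.of_forall fun S i => ?_
    have : ∀ x : Space n, crossingSet R T S (a - height R x) (b - height R x) x x = ∅ := fun x =>
      Set.eq_empty_of_forall_notMem fun z hz => hz.2.1 hz.1
    simp [this]
  · intro i j
    have h1 := (tendsto_count_cube_diff hT R (i : L) j (a - height R j) (b - height R j)).add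
      (tendsto_count_cube_diff hT R j (i : L) (a - height R j) (b - height R j))
    rw [add_zero] at h1
    exact h1.congr fun S => (ENNReal.add_div).symm

-- The competitor is `levelSpin v t` in the cube of side `θ S` and the half space `w` outside. A
-- pair with both sites on one side costs the same as in that piece. For a pair across the boundary
-- the spin at the second site is exchanged, at cost at most `1`, and only where the two spins
-- disagree.
open Classical in
theorem dirichletCell_upper_bound {T : ℕ} (hT : 0 < T) {L : Set (Space n)}
    (hL : UniformlyDiscrete L) {hP : PeriodicSet T L} {c : L → L → ℝ≥0} (hc : PeriodicCoeff T c)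
    (hd : DecayCoeff c) {R : Space n ≃ₗᵢ[ℝ] Space n} {ν : Space n}
    (hR : R (lastBasisVector n) = ν) {G : ℝ → ℝ} (hG : IsLimitDistribution R T G) {v : L → ℝ}
    (hv : IsEquivariant hP R v) (t : ℝ) {δ : ℝ} (hδ : δ ∈ Set.Ioo (0 : ℝ) 1) :
    ∃ f : ℝ → ℝ≥0∞,
      (∀ S, dirichletCell c R ν δ S / ENNReal.ofReal (S ^ n) ≤ f S) ∧
      Tendsto f atTop (𝓝 (ENNReal.ofReal ((1 - δ) ^ n) * levelDensity T c G v t +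
        ENNReal.ofReal (1 - (1 - δ) ^ n) *
          levelDensity T c G (fun x : L => height R x) 0)) := by
  obtain ⟨P, hP0, hPv⟩ := hv.exists_abs_sub_le hT hL
  set θ := 1 - δ with hθ
  have hθ0 : 0 < θ := by linarith [hδ.2]
  have hθ1 : θ ≤ 1 := by linarith [hδ.1]
  set M := P + |t| with hM
  have hM0 : 0 ≤ M := by positivity
  set w : L → ℝ := levelSpin (fun x : L => height R x) 0 with hw
  set X : ℝ → ℝ≥0∞ := fun S => ∑' i : Base T L, ∑' j : L, (c i j : ℝ≥0∞) *
      (Measure.count (crossingSet R T S (-M - height R j) (M + 1 - height R j) (i : L) j) +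
        Measure.count (crossingSet R T S (-M - height R j) (M + 1 - height R j) j (i : L))) with hX
  refine ⟨fun S => energy c (levelSpin v t) (R '' cube n (θ * S)) / ENNReal.ofReal (S ^ n) +
    energy c w (R '' cube n S \ R '' cube n (θ * S)) / ENNReal.ofReal (S ^ n) +
    X (θ * S) / ENNReal.ofReal (S ^ n), fun S => ?_, ?_⟩
  · simp only
    rw [← ENNReal.add_div, ← ENNReal.add_div]
    refine ENNReal.div_le_div_right ?_ _
    obtain ⟨u, hui, huo⟩ : ∃ u : L → ℝ,
        (∀ x : L, (x : Space n) ∈ R '' cube n (θ * S) → u x = levelSpin v t x) ∧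
        ∀ x : L, (x : Space n) ∉ R '' cube n (θ * S) → u x = w x :=
      ⟨fun x => if (x : Space n) ∈ R '' cube n (θ * S) then levelSpin v t x else w x,
        fun x hx => if_pos hx, fun x hx => if_neg hx⟩
    have hadm : u ∈ {u : L → ℝ | (∀ i, u i = 0 ∨ u i = 1) ∧
        ∀ i : L, (i : Space n) ∉ R '' cube n ((1 - δ) * S) → u i = halfSpaceSpin ν i} := by
      refine ⟨fun x => ?_, fun x hx => ?_⟩
      · by_cases h : (x : Space n) ∈ R '' cube n (θ * S)
        · rw [hui x h]; exact levelSpin_eq_zero_or_one _ _ _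
        · rw [huo x h]; exact levelSpin_eq_zero_or_one _ _ _
      · rw [huo x hx, halfSpaceSpin_eq_levelSpin hR]
    refine (iInf₂_le u hadm).trans ?_
    rw [energy_eq_tsum hT hP hc, energy_eq_tsum hT hP hc, energy_eq_tsum hT hP hc, hX,
      ← ENNReal.tsum_add, ← ENNReal.tsum_add]
    refine ENNReal.tsum_le_tsum fun i => ?_
    rw [← ENNReal.tsum_add, ← ENNReal.tsum_add]
    refine ENNReal.tsum_le_tsum fun j => ?_
    rw [← mul_add, ← mul_add]
    gcongr
    rw [← tsum_indicator_one, ← tsum_indicator_one, pairEnergy, pairEnergy, pairEnergy,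
      ← ENNReal.tsum_add, ← ENNReal.tsum_add, ← ENNReal.tsum_add]
    refine ENNReal.tsum_le_tsum fun z => ?_
    simp only [Set.indicator_apply, Set.mem_ofPred_eq, Set.mem_sdiff, crossingSet]
    set i' := translate hP i z with hi'
    set j' := translate hP j z with hj'
    -- `{v ≥ t}` and the half space differ only at heights of modulus at most `P + |t| = M`, which
    -- puts the costly pairs in a crossing set.
    have hne : levelSpin v t j' ≠ w j' → -M - height R j ≤ height R (shift T z) ∧
        height R (shift T z) < M + 1 - height R j := by
      intro hne
      have h1 := abs_le.1 (hPv j')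
      have h2 : height R (j' : Space n) = height R j + height R (shift T z) := by
        rw [hj', coe_translate, height_add]
      have h3 := neg_abs_le t
      have h4 := le_abs_self t
      by_cases h5 : t ≤ v j' <;> by_cases h6 : 0 ≤ height R (j' : Space n)
      · simp [levelSpin, hw, h5, h6] at hne
      · rw [h2] at h6 h1; constructor <;> linarith
      · rw [h2] at h6 h1; constructor <;> linarith
      · simp [levelSpin, hw, h5, h6] at hne
    have hdiff : ∀ a : ℝ, ENNReal.ofReal (a - levelSpin v t j') ≤ ENNReal.ofReal (a - w j') +
        ENNReal.ofReal |levelSpin v t j' - w j'| ∧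
        ENNReal.ofReal (a - w j') ≤ ENNReal.ofReal (a - levelSpin v t j') +
        ENNReal.ofReal |levelSpin v t j' - w j'| := by
      intro a
      constructor
      · refine (ENNReal.ofReal_le_ofReal ?_).trans ENNReal.ofReal_add_le
        linarith [neg_abs_le (levelSpin v t j' - w j')]
      · refine (ENNReal.ofReal_le_ofReal ?_).trans ENNReal.ofReal_add_le
        linarith [le_abs_self (levelSpin v t j' - w j')]
    have hone : ENNReal.ofReal |levelSpin v t j' - w j'| ≤ 1 := by
      rcases levelSpin_eq_zero_or_one v t j' with h | h <;>
      rcases levelSpin_eq_zero_or_one (fun x : L => height R x) 0 j' with h' | h' <;>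
      simp [hw, h, h']
    by_cases hS : ((i : L) : Space n) + shift T z ∈ R '' cube n S
    swap
    · simp only [hS, if_false]; exact zero_le
    by_cases hi : ((i : L) : Space n) + shift T z ∈ R '' cube n (θ * S) <;>
    by_cases hj : (j : Space n) + shift T z ∈ R '' cube n (θ * S) <;>
    simp only [hS, hi, hj, not_true, not_false_iff, if_true, if_false, and_true, and_false,
      true_and, false_and, add_zero, zero_add]
    · rw [hui i' hi, hui j' hj]
    · rw [hui i' hi, huo j' hj]
      by_cases he : levelSpin v t j' = w j'
      · rw [he]; exact le_self_add
      · rw [if_pos (hne he)]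
        exact (hdiff _).2.trans (by gcongr)
    · rw [huo i' hi, hui j' hj]
      by_cases he : levelSpin v t j' = w j'
      · rw [he]; exact le_self_add
      · rw [if_pos (hne he)]
        exact (hdiff _).1.trans (by gcongr)
    · rw [huo i' hi, huo j' hj]
  · have h1 := tendsto_scale (tendsto_energy_levelSpin hT hL hc hd hG hv t).1 hθ0
    have h2 := tendsto_energy_annulus hT hL hc hd hG (isEquivariant_height hP R) 0 hθ0 hθ1
    have h3 := tendsto_scale (tendsto_tsum_crossing (T := T) hT hL hd R
      (a := -M) (b := M + 1) (by linarith)) hθ0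
    rw [mul_zero] at h3
    have := (h1.add h2).add h3
    rwa [add_zero] at this

/-! ### Lower bound: long pairs across the buffer. -/

/-- The indices which move `x` out of the cube of size `θ S` and `y` into that of size `κ S`. -/
def farSet (R : Space n ≃ₗᵢ[ℝ] Space n) (T : ℕ) (κ θ S : ℝ) (x y : Space n) : Set (Idx n) :=
  {z | x + shift T z ∉ R '' cube n (θ * S) ∧ y + shift T z ∈ R '' cube n (κ * S)}

theorem mem_image_cube_of_norm_sub_le {R : Space n ≃ₗᵢ[ℝ] Space n} {S S' m : ℝ} {x y : Space n}
    (hx : x ∈ R '' cube n S) (hxy : ‖x - y‖ ≤ m) (h : S + 2 * m ≤ S') :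
    y ∈ R '' cube n S' := by
  rw [mem_image_cube] at hx ⊢
  exact mem_slabBox_of_norm_sub_le (a := -(S / 2)) (b := S / 2) hx hxy h (by linarith)
    (by linarith)

theorem farSet_eq_empty (R : Space n ≃ₗᵢ[ℝ] Space n) (T : ℕ) {κ θ S : ℝ} {x y : Space n}
    (h : 2 * ‖x - y‖ ≤ (θ - κ) * S) : farSet R T κ θ S x y = ∅ := by
  refine Set.eq_empty_of_forall_notMem fun z hz => hz.1 ?_
  refine mem_image_cube_of_norm_sub_le (m := ‖x - y‖) hz.2 ?_ (by linarith)
  rw [norm_sub_rev]; simp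

/-- Such pairs have length more than `(θ - κ) S / 2`, so one factor `S` in the trivial count of
order `S^(n+1)` can be traded for `‖x - y‖`. -/
theorem exists_count_farSet_le (n : ℕ) {T : ℕ} (hT : 0 < T) {κ θ : ℝ} (hκ : 0 < κ) (hκ1 : κ ≤ 1)
    (hκθ : κ < θ) : ∃ C : ℝ, 0 < C ∧ ∀ (R : Space n ≃ₗᵢ[ℝ] Space n) (S : ℝ) (x y : Space n),
      κ⁻¹ ≤ S → Measure.count (farSet R T κ θ S x y) ≤
        ENNReal.ofReal (C * S ^ n * ‖x - y‖) := by
  obtain ⟨C, hC, hcount⟩ := exists_count_cube_le n hT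
  have hd : 0 < θ - κ := sub_pos.2 hκθ
  refine ⟨C * (2 / (θ - κ)), by positivity, fun R S x y hS => ?_⟩
  have hS0 : 0 < S := lt_of_lt_of_le (by positivity) hS
  have hκS : 1 ≤ κ * S := by
    rw [← mul_inv_cancel₀ hκ.ne']; gcongr
  rcases le_or_gt (2 * ‖x - y‖) ((θ - κ) * S) with h | h
  · rw [farSet_eq_empty R T h, measure_empty]; exact zero_le
  · refine (measure_mono fun z hz => hz.2).trans ((hcount R (κ * S) y hκS).trans
      (ENNReal.ofReal_le_ofReal ?_))
    have h1 : S ≤ 2 / (θ - κ) * ‖x - y‖ := by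
      rw [div_mul_eq_mul_div, le_div_iff₀ hd]; linarith
    have h2 : κ * S ≤ S := by nlinarith
    calc C * (κ * S) ^ n * (κ * S) ≤ C * S ^ n * (2 / (θ - κ) * ‖x - y‖) := by
          exact mul_le_mul (mul_le_mul_of_nonneg_left (pow_le_pow_left₀ (by linarith) h2 n) hC.le)
            (h2.trans h1) (by linarith) (by positivity)
      _ = _ := by ring

theorem hasSum_indicator_one {A : Set (Idx n)} (hA : Measure.count A ≠ ⊤) :
    HasSum (A.indicator fun _ => (1 : ℝ)) (Measure.count A).toReal := by
  rw [← tsum_indicator_one] at hA ⊢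
  rw [ENNReal.tsum_toReal_eq fun z => ?_]
  · convert ENNReal.hasSum_toReal hA using 1
    funext z
    by_cases h : z ∈ A <;> simp [h]
  · by_cases h : z ∈ A <;> simp [h]

/-! ### Lower bound: the periodic competitor. -/

/-- The defect between the number of lattice points in the slab bounded by the heights of `x` and
`y` and its limit value. -/
def slabDefect (R : Space n ≃ₗᵢ[ℝ] Space n) (T : ℕ) (G : ℝ → ℝ) (S : ℝ) (x y : Space n) : ℝ :=
  S ^ n * (G (-height R y) - G (-height R x)) -
    ((Measure.count (slabSet R T S 0 (-height R x) (-height R y))).toReal -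
      (Measure.count (slabSet R T S 0 (-height R y) (-height R x))).toReal)

/-- The competitor for the periodic cell problem built from a spin function `u`. -/
def periodicCompetitor {T : ℕ} {L : Set (Space n)} (hP : PeriodicSet T L)
    (R : Space n ≃ₗᵢ[ℝ] Space n) (G : ℝ → ℝ) (S : ℝ) (u : L → ℝ) (x : L) : ℝ :=
  ∑' z : Idx n, (u (translate hP x z) - levelSpin (fun x : L => height R x) 0 (translate hP x z)) -
    S ^ n * G (-height R x)

/-- The sum over the whole lattice is invariant under reindexing, and `G` alone produces the linear
growth. -/
theorem periodicFun_periodicCompetitor {T : ℕ} {L : Set (Space n)} (hP : PeriodicSet T L)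
    {R : Space n ≃ₗᵢ[ℝ] Space n} {ν : Space n} (hR : R (lastBasisVector n) = ν) {G : ℝ → ℝ}
    (hG : IsLimitDistribution R T G) (S : ℝ) (u : L → ℝ) :
    PeriodicFun T fun i : L => periodicCompetitor hP R G S u i -
      inner ℝ ((S ^ n / (T : ℝ) ^ (n + 1)) • ν) (i : Space n) := by
  intro z x y hxy
  obtain rfl : y = translate hP x z := Subtype.ext hxy
  have h1 : ∑' w : Idx n, (u (translate hP (translate hP x z) w) -
      levelSpin (fun x : L => height R x) 0 (translate hP (translate hP x z) w)) =
      ∑' w : Idx n, (u (translate hP x w) -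
        levelSpin (fun x : L => height R x) 0 (translate hP x w)) := by
    simp_rw [translate_translate]
    exact (Equiv.addLeft z).tsum_eq fun w => u (translate hP x w) -
      levelSpin (fun x : L => height R x) 0 (translate hP x w)
  have h2 := hG.add_height (-height R x) (-z)
  rw [shift_neg, height_neg] at h2
  simp only [periodicCompetitor, h1, real_inner_smul_left, inner_eq_height hR, coe_translate,
    height_add, neg_add, h2]
  ring

/-- Compare term by term in `z`. If `Tz` is in the cylinder, the `w` part is a difference of slab
indicators, whose count cancels the `G` terms up to `slabDefect`. If not, `i + Tz` is outside the
cube of side `κ S` since `‖i‖ ≤ D`, so `u = w` there; what remains comes from `j` and is paid by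
`farSet`. -/
theorem ofReal_periodicCompetitor_sub_le {T : ℕ} (hT : 0 < T) {L : Set (Space n)}
    (hP : PeriodicSet T L) (R : Space n ≃ₗᵢ[ℝ] Space n) (G : ℝ → ℝ) {κ θ S D : ℝ}
    (hκS : 1 ≤ κ * S) (hθS : 0 ≤ θ * S)
    (hSD : 2 * D ≤ (θ - κ) * S) {u : L → ℝ} (hu : ∀ x, u x = 0 ∨ u x = 1)
    (hu' : ∀ x : L, (x : Space n) ∉ R '' cube n (κ * S) →
      u x = levelSpin (fun x : L => height R x) 0 x) {i : L} (hi : ‖(i : Space n)‖ ≤ D) (j : L) :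
    ENNReal.ofReal (periodicCompetitor hP R G (θ * S) u i - periodicCompetitor hP R G (θ * S) u j) ≤
      ∑' z : Idx n, {z : Idx n | shift T z ∈ cyl R (θ * S)}.indicator
        (fun z => ENNReal.ofReal (u (translate hP i z) - u (translate hP j z))) z +
      Measure.count (farSet R T κ θ S 0 j) +
      ENNReal.ofReal |slabDefect R T G (θ * S) i j| := by
  classical
  obtain ⟨C, hC, hcount⟩ := exists_count_cube_le n hT
  set w : L → ℝ := levelSpin (fun x : L => height R x) 0 with hw
  set p : Idx n → ℝ≥0∞ := {z : Idx n | shift T z ∈ cyl R (θ * S)}.indicator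
        (fun z => ENNReal.ofReal (u (translate hP i z) - u (translate hP j z))) with hp
  by_cases htop : ∑' z, p z = ⊤
  · simp [htop]
  have hcube : ∀ x : L, Measure.count {z : Idx n | (x : Space n) + shift T z ∈ R '' cube n (κ * S)}
      ≠ ⊤ := fun x => ((hcount R (κ * S) x hκS).trans_lt ENNReal.ofReal_lt_top).ne
  have hsum : ∀ x : L, Summable fun z : Idx n => u (translate hP x z) - w (translate hP x z) := by
    intro x
    refine summable_of_hasFiniteSupport ((Measure.count_apply_lt_top.1 (hcube x).lt_top).subset ?_)
    intro z hz
    by_contra h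
    exact hz (by simp only; rw [hu' (translate hP x z) h, sub_self])
  have hfar : Measure.count (farSet R T κ θ S 0 j) ≠ ⊤ :=
    ne_top_of_le_ne_top (hcube j) (measure_mono fun z hz => hz.2)
  have H := (((ENNReal.hasSum_toReal htop).add (hasSum_indicator_one hfar)).sub
    ((hasSum_indicator_one (count_slabSet_ne_top hT R hθS 0 (-height R i) (-height R j))).sub
    (hasSum_indicator_one (count_slabSet_ne_top hT R hθS 0 (-height R j) (-height R i)))))
  have H2 := (hsum i).hasSum.sub (hsum j).hasSum
  have hle := hasSum_le (fun z => ?_) H2 H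
  · rw [← ENNReal.tsum_toReal_eq fun z => ?_] at hle
    · have h3 : periodicCompetitor hP R G (θ * S) u i - periodicCompetitor hP R G (θ * S) u j ≤
          (∑' z, p z).toReal + (Measure.count (farSet R T κ θ S 0 j)).toReal +
            |slabDefect R T G (θ * S) i j| := by
        have := le_abs_self (slabDefect R T G (θ * S) i j)
        simp only [periodicCompetitor, slabDefect] at this ⊢
        linarith
      refine (ENNReal.ofReal_le_ofReal h3).trans (ENNReal.ofReal_add_le.trans ?_)
      gcongr
      refine ENNReal.ofReal_add_le.trans ?_
      rw [ENNReal.ofReal_toReal htop, ENNReal.ofReal_toReal hfar]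
    · by_cases h : shift T z ∈ cyl R (θ * S) <;> simp [hp, h]
  · simp only [hp, Set.indicator_apply, Set.mem_ofPred_eq]
    have hwd : w (translate hP i z) - w (translate hP j z) =
        (if -height R i ≤ height R (shift T z) ∧ height R (shift T z) < -height R j
          then 1 else 0) -
        (if -height R j ≤ height R (shift T z) ∧ height R (shift T z) < -height R i
          then 1 else 0) := by
      simp only [hw, levelSpin, coe_translate, height_add, ← not_le, neg_le_iff_add_nonneg']
      by_cases h1 : 0 ≤ height R i + height R (shift T z) <;>
      by_cases h2 : 0 ≤ height R j + height R (shift T z) <;> simp only [h1, h2] <;> simp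
    by_cases hz : shift T z ∈ cyl R (θ * S)
    · have h4 : ∀ (s : Prop) [Decidable s], (0 : ℝ) ≤ if s then 1 else 0 := fun s _ => by
        split_ifs <;> norm_num
      have h5 := h4 (z ∈ farSet R T κ θ S 0 j)
      have h6 := ENNReal.toReal_ofReal' (r := u (translate hP i z) - u (translate hP j z))
      have h7 := le_max_left (u (translate hP i z) - u (translate hP j z)) 0
      simp only [slabSet, Set.mem_ofPred_eq, zero_add, hz, true_and, if_true]
      rw [h6]
      linarith
    · have h8 : u (translate hP i z) = w (translate hP i z) := by
        refine hu' _ fun h => hz ?_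
        refine (mem_image_cube.1 (mem_image_cube_of_norm_sub_le (m := D) h ?_ (by linarith))).1
        simpa using hi
      simp only [slabSet, Set.mem_ofPred_eq, zero_add, hz, false_and, if_false, h8]
      by_cases h9 : (j : Space n) + shift T z ∈ R '' cube n (κ * S)
      · have h10 : z ∈ farSet R T κ θ S 0 j := by
          refine ⟨fun h => hz ?_, h9⟩
          rw [zero_add] at h
          exact (mem_image_cube.1 h).1
        rw [if_pos h10]
        rcases hu (translate hP j z) with h | h <;>
        rcases levelSpin_eq_zero_or_one (fun x : L => height R x) 0 (translate hP j z)
          with h' | h' <;> simp [h, hw, h']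
      · rw [hu' _ h9]
        have : z ∉ farSet R T κ θ S 0 j := fun h => h9 h.2
        simp [this]

/-- The indices of pairs separated by the hyperplane for which `x` is moved to a large height. -/
def highSet (R : Space n ≃ₗᵢ[ℝ] Space n) (T : ℕ) (θ S : ℝ) (x y : Space n) : Set (Idx n) :=
  {z ∈ slabSet R T S x (-height R x) (-height R y) |
    ¬(-(θ * S / 2) ≤ height R (x + shift T z) ∧ height R (x + shift T z) < θ * S / 2)}

/-- The indices of pairs separated by the hyperplane in the cylinder of size `θ S`, for which `x` is
moved out of the cylinder. -/
def edgeSet (R : Space n ≃ₗᵢ[ℝ] Space n) (T : ℕ) (θ S : ℝ) (x y : Space n) : Set (Idx n) :=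
  {z ∈ slabSet R T (θ * S) 0 (-height R x) (-height R y) | x + shift T z ∉ cyl R (θ * S)}

/-- Let `z` be outside the exceptional set. If `i + Tz` is in the cube of side `θ S`, the annulus
term vanishes. If not, `u = w` at both sites, and when `Tz` is in the cylinder `w` has no downward
jump from `i` to `j`, so the two left terms never count the same energy twice. Exceptional indices
cost at most `1`. -/
theorem indicator_cylinder_add_annulus_le {T : ℕ} {L : Set (Space n)} (hP : PeriodicSet T L)
    (R : Space n ≃ₗᵢ[ℝ] Space n) {κ θ S : ℝ} (hS : 0 ≤ S) (hκθ : κ ≤ θ) (hθ : θ ≤ 1)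
    {u : L → ℝ} (hu : ∀ x, u x = 0 ∨ u x = 1)
    (hu' : ∀ x : L, (x : Space n) ∉ R '' cube n (κ * S) →
      u x = levelSpin (fun x : L => height R x) 0 x) (i j : L) (z : Idx n) :
    {z : Idx n | shift T z ∈ cyl R (θ * S)}.indicator
        (fun z => ENNReal.ofReal (u (translate hP i z) - u (translate hP j z))) z +
      {z : Idx n | (i : Space n) + shift T z ∈ R '' cube n S \ R '' cube n (θ * S)}.indicator
        (fun z => ENNReal.ofReal (levelSpin (fun x : L => height R x) 0 (translate hP i z) -
          levelSpin (fun x : L => height R x) 0 (translate hP j z))) z ≤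
      {z : Idx n | (i : Space n) + shift T z ∈ R '' cube n S}.indicator
        (fun z => ENNReal.ofReal (u (translate hP i z) - u (translate hP j z))) z +
      (farSet R T κ θ S i j ∪ highSet R T θ S i j ∪ edgeSet R T θ S i j).indicator
        (fun _ => 1) z := by
  classical
  set w : L → ℝ := levelSpin (fun x : L => height R x) 0 with hw
  set B := farSet R T κ θ S (i : Space n) j ∪ highSet R T θ S (i : Space n) j ∪
    edgeSet R T θ S (i : Space n) j with hB
  simp only [Set.indicator_apply, Set.mem_ofPred_eq, Set.mem_sdiff]
  set i' := translate hP i z with hi'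
  set j' := translate hP j z with hj'
  have hle1 : ∀ a b : ℝ, (a = 0 ∨ a = 1) → (b = 0 ∨ b = 1) → ENNReal.ofReal (a - b) ≤ 1 := by
    rintro a b (rfl | rfl) (rfl | rfl) <;> simp
  have hu1 := hle1 _ _ (hu i') (hu j')
  have hw1 := hle1 _ _ (levelSpin_eq_zero_or_one (fun x : L => height R x) 0 i')
    (levelSpin_eq_zero_or_one (fun x : L => height R x) 0 j')
  have hθS : R '' cube n (θ * S) ⊆ R '' cube n S := image_cube_mono R (by nlinarith)
  have hκS : R '' cube n (κ * S) ⊆ R '' cube n (θ * S) := image_cube_mono R (by nlinarith)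
  have hflat : z ∉ B → (i : Space n) + shift T z ∉ R '' cube n (θ * S) →
      ENNReal.ofReal (u i' - u j') = ENNReal.ofReal (w i' - w j') := by
    intro hz hi
    rw [hu' i' fun h => hi (hκS h), hu' j' fun h => hz (Or.inl (Or.inl ⟨hi, h⟩))]
  have hzero : z ∉ B → (i : Space n) + shift T z ∉ R '' cube n (θ * S) →
      shift T z ∈ cyl R (θ * S) → ENNReal.ofReal (w i' - w j') = 0 := by
    intro hz hi hC
    rw [hw, ofReal_levelSpin_sub]
    refine if_neg fun h => ?_
    simp only [hi', hj', coe_translate, height_add] at h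
    have h1 : -height R (i : Space n) ≤ height R (shift T z) := by linarith [h.1]
    have h2 : height R (shift T z) < -height R (j : Space n) := by linarith [h.2]
    have h3 : (i : Space n) + shift T z ∈ cyl R (θ * S) := by
      by_contra h3
      exact hz (Or.inr ⟨⟨by simpa using hC, h1, h2⟩, h3⟩)
    refine hz (Or.inl (Or.inr ⟨⟨mem_cyl_of_norm_sub_le (m := 0) h3 (by simp) (by nlinarith),
      h1, h2⟩, fun h4 => hi (mem_image_cube.2 ⟨h3, h4⟩)⟩))
  by_cases hz : z ∈ B
  · rw [if_pos hz]
    by_cases hi : (i : Space n) + shift T z ∈ R '' cube n S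
    · rw [if_pos hi]
      refine add_le_add ?_ ?_
      · split_ifs
        · exact le_rfl
        · exact zero_le
      · split_ifs
        · exact hw1
        · exact zero_le
    · rw [if_neg (fun h : _ ∧ _ => hi h.1), if_neg hi, add_zero, zero_add]
      split_ifs
      · exact hu1
      · exact zero_le
  · rw [if_neg hz, add_zero]
    by_cases hi : (i : Space n) + shift T z ∈ R '' cube n (θ * S)
    · rw [if_neg (fun h : _ ∧ ¬_ => h.2 hi), if_pos (hθS hi), add_zero]
      split_ifs
      · exact le_rfl
      · exact zero_le
    · by_cases hC : shift T z ∈ cyl R (θ * S)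
      · rw [hflat hz hi, hzero hz hi hC]; simp
      · rw [if_neg hC, zero_add, hflat hz hi]
        by_cases h : (i : Space n) + shift T z ∈ R '' cube n S
        · rw [if_pos h, if_pos ⟨h, hi⟩]
        · rw [if_neg h, if_neg fun hcube => h hcube.1]

/-! ### Lower bound: the errors are negligible and dominated. -/

/-- The error committed for the pair `(x, y)` in the lower bound. -/
def lowerError (R : Space n ≃ₗᵢ[ℝ] Space n) (T : ℕ) (G : ℝ → ℝ) (κ θ S : ℝ) (x y : Space n) :
    ℝ≥0∞ :=
  Measure.count (farSet R T κ θ S x y) + Measure.count (highSet R T θ S x y) +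
    Measure.count (edgeSet R T θ S x y) + Measure.count (farSet R T κ θ S 0 y) +
    ENNReal.ofReal |slabDefect R T G (θ * S) x y|

theorem exists_count_slabSet_height_le (n : ℕ) {T : ℕ} (hT : 0 < T) :
    ∃ C : ℝ, 0 < C ∧ ∀ (R : Space n ≃ₗᵢ[ℝ] Space n) (S : ℝ) (p x y : Space n), 1 ≤ S →
      Measure.count (slabSet R T S p (-height R x) (-height R y)) ≤
        ENNReal.ofReal (C * S ^ n * (1 + ‖x - y‖)) := by
  obtain ⟨C, hC, hcount⟩ := exists_count_slabSet_le n hT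
  refine ⟨C, hC, fun R S p x y hS => ?_⟩
  rcases le_or_gt (-height R x) (-height R y) with h | h
  · refine (hcount R S _ _ p hS h).trans (ENNReal.ofReal_le_ofReal ?_)
    have h1 := (abs_le.1 (abs_height_le R (x - y))).2
    rw [height_sub] at h1
    have : 0 < C * S ^ n := by positivity
    exact mul_le_mul_of_nonneg_left (by linarith) this.le
  · have : slabSet R T S p (-height R x) (-height R y) = ∅ :=
      Set.eq_empty_of_forall_notMem fun z hz => absurd (hz.2.1.trans_lt hz.2.2) h.not_gt
    rw [this, measure_empty]
    exact zero_le

theorem IsLimitDistribution.exists_abs_sub_le {T : ℕ} (hT : 0 < T) {R : Space n ≃ₗᵢ[ℝ] Space n}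
    {G : ℝ → ℝ} (hG : IsLimitDistribution R T G) : ∃ C : ℝ, 0 < C ∧ ∀ x y : Space n,
      |G (-height R y) - G (-height R x)| ≤ C * (1 + ‖x - y‖) := by
  obtain ⟨C, hC, hcount⟩ := exists_count_slabSet_height_le n hT
  have key : ∀ x y : Space n, G (-height R y) - G (-height R x) ≤ C * (1 + ‖x - y‖) := by
    intro x y
    rw [← ENNReal.ofReal_le_ofReal_iff (by positivity)]
    refine le_of_tendsto (hG.tendsto 0 _ _) ?_
    filter_upwards [eventually_ge_atTop 1] with S hS
    have hS0 : 0 < S := by linarith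
    refine ENNReal.div_le_of_le_mul ?_
    rw [← ENNReal.ofReal_mul (by positivity)]
    exact (hcount R S 0 x y hS).trans (ENNReal.ofReal_le_ofReal (le_of_eq (by ring)))
  refine ⟨C, hC, fun x y => abs_le.2 ⟨?_, key x y⟩⟩
  have := key y x
  rw [norm_sub_rev] at this
  linarith

theorem exists_slabDefect_le {T : ℕ} (hT : 0 < T) {R : Space n ≃ₗᵢ[ℝ] Space n}
    {G : ℝ → ℝ} (hG : IsLimitDistribution R T G) : ∃ C : ℝ, 0 < C ∧ ∀ (S : ℝ) (x y : Space n),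
      1 ≤ S → |slabDefect R T G S x y| ≤ C * S ^ n * (1 + ‖x - y‖) := by
  obtain ⟨C, hC, hcount⟩ := exists_count_slabSet_height_le n hT
  obtain ⟨C', hC', hG'⟩ := hG.exists_abs_sub_le hT
  refine ⟨C' + 2 * C, by positivity, fun S x y hS => ?_⟩
  have hSn : 0 ≤ S ^ n := by positivity
  have h1 := ENNReal.toReal_mono ENNReal.ofReal_ne_top (hcount R S 0 x y hS)
  have h2 := ENNReal.toReal_mono ENNReal.ofReal_ne_top (hcount R S 0 y x hS)
  rw [ENNReal.toReal_ofReal (by positivity)] at h1 h2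
  rw [norm_sub_rev y x] at h2
  have h3 := mul_le_mul_of_nonneg_left (hG' x y) hSn
  calc |slabDefect R T G S x y|
      ≤ |S ^ n * (G (-height R y) - G (-height R x))| +
        (|(Measure.count (slabSet R T S 0 (-height R x) (-height R y))).toReal| +
        |(Measure.count (slabSet R T S 0 (-height R y) (-height R x))).toReal|) :=
        (abs_sub _ _).trans (add_le_add le_rfl (abs_sub _ _))
    _ ≤ _ := by
        rw [abs_mul, abs_of_nonneg hSn, abs_of_nonneg ENNReal.toReal_nonneg,
          abs_of_nonneg ENNReal.toReal_nonneg]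
        linarith

theorem tendsto_slabDefect {T : ℕ} {R : Space n ≃ₗᵢ[ℝ] Space n}
    {G : ℝ → ℝ} (hG : IsLimitDistribution R T G) (x y : Space n) :
    Tendsto (fun S : ℝ => ENNReal.ofReal |slabDefect R T G S x y| / ENNReal.ofReal (S ^ n)) atTop
      (𝓝 0) := by
  have h1 : ∀ a b : ℝ, Tendsto (fun S : ℝ => (Measure.count (slabSet R T S 0 a b)).toReal / S ^ n)
      atTop (𝓝 (max (G b - G a) 0)) := by
    intro a b
    have := (ENNReal.tendsto_toReal ENNReal.ofReal_ne_top).comp (hG.tendsto 0 a b)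
    rw [ENNReal.toReal_ofReal'] at this
    refine this.congr' ?_
    filter_upwards [eventually_gt_atTop 0] with S hS
    rw [Function.comp, ENNReal.toReal_div, ENNReal.toReal_ofReal (by positivity)]
  set g := G (-height R y) - G (-height R x) with hg
  have h2 := (tendsto_const_nhds (x := g)).sub
    ((h1 (-height R x) (-height R y)).sub (h1 (-height R y) (-height R x)))
  -- The two one-sided counts converge to the positive and negative parts of `g`, whose difference
  -- is `g`.
  have h3 : g - (max (G (-height R y) - G (-height R x)) 0 -
      max (G (-height R x) - G (-height R y)) 0) = 0 := by
    rw [← neg_sub (G (-height R y)), ← hg]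
    rcases le_total 0 g with h | h
    · rw [max_eq_left h, max_eq_right (by linarith)]; ring
    · rw [max_eq_right h, max_eq_left (by linarith)]; ring
  rw [h3] at h2
  have h4 := ENNReal.tendsto_ofReal h2.abs
  rw [abs_zero, ENNReal.ofReal_zero] at h4
  refine h4.congr' ?_
  filter_upwards [eventually_gt_atTop 0] with S hS
  rw [ofReal_div_ofReal_pow hS]
  congr 1
  have hSn : 0 < S ^ n := by positivity
  rw [← abs_of_pos hSn, ← abs_div, abs_of_pos hSn, slabDefect, ← hg, sub_div, sub_div,
    mul_div_cancel_left₀ _ hSn.ne']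

/-- For a fixed pair the far and high sets are eventually empty, the edge set is a boundary effect,
and the slab defect is `o(S^n)`. -/
theorem tendsto_lowerError {T : ℕ} (hT : 0 < T) {R : Space n ≃ₗᵢ[ℝ] Space n}
    {G : ℝ → ℝ} (hG : IsLimitDistribution R T G) {κ θ : ℝ} (hκ : 0 < κ) (hκθ : κ < θ)
    (x y : Space n) :
    Tendsto (fun S : ℝ => lowerError R T G κ θ S x y / ENNReal.ofReal (S ^ n)) atTop (𝓝 0) := by
  have hθ : 0 < θ := hκ.trans hκθ
  have hzero : ∀ {f : ℝ → ℝ≥0∞}, (∀ᶠ S in atTop, f S = 0) →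
      Tendsto (fun S : ℝ => f S / ENNReal.ofReal (S ^ n)) atTop (𝓝 0) := by
    intro f hf
    refine tendsto_const_nhds.congr' ?_
    filter_upwards [hf] with S hS
    rw [hS, ENNReal.zero_div]
  have hfar : ∀ x y : Space n, ∀ᶠ S in atTop, Measure.count (farSet R T κ θ S x y) = 0 := by
    intro x y
    filter_upwards [eventually_ge_atTop (2 * ‖x - y‖ / (θ - κ))] with S hS
    rw [div_le_iff₀' (sub_pos.2 hκθ)] at hS
    rw [farSet_eq_empty R T hS, measure_empty]
  have hhigh : ∀ᶠ S in atTop, Measure.count (highSet R T θ S x y) = 0 := by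
    filter_upwards [eventually_ge_atTop (2 * (height R x - height R y) / θ), eventually_ge_atTop 0]
      with S hS hS0
    rw [div_le_iff₀' hθ] at hS
    have : highSet R T θ S x y = ∅ := by
      refine Set.eq_empty_of_forall_notMem fun z hz => hz.2 ?_
      rw [height_add]
      have h1 := hz.1.2.1
      have h2 := hz.1.2.2
      have h3 : 0 ≤ θ * S := by positivity
      constructor <;> linarith
    rw [this, measure_empty]
  have hedge := tendsto_scale
    (tendsto_count_slabSet_diff hT R 0 x (-height R x) (-height R y)) hθ
  have hdef := tendsto_scale (tendsto_slabDefect hG x y) hθ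
  rw [mul_zero] at hedge hdef
  have := ((((hzero (hfar x y)).add (hzero hhigh)).add hedge).add (hzero (hfar 0 y))).add hdef
  simp only [add_zero] at this
  refine this.congr fun S => ?_
  simp only [lowerError, ENNReal.add_div]
  rfl

theorem exists_lowerError_le {T : ℕ} (hT : 0 < T) {R : Space n ≃ₗᵢ[ℝ] Space n}
    {G : ℝ → ℝ} (hG : IsLimitDistribution R T G) {κ θ : ℝ} (hκ : 0 < κ) (hκθ : κ < θ)
    (hθ1 : θ ≤ 1) {D : ℝ} (hD : 0 ≤ D) : ∃ C : ℝ, 0 ≤ C ∧ ∀ᶠ S : ℝ in atTop, ∀ x y : Space n,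
      ‖x‖ ≤ D → lowerError R T G κ θ S x y ≤ ENNReal.ofReal (C * S ^ n * (1 + ‖x - y‖)) := by
  have hθ : 0 < θ := hκ.trans hκθ
  obtain ⟨C₁, hC₁, hfar⟩ := exists_count_farSet_le n hT hκ (hκθ.le.trans hθ1) hκθ
  obtain ⟨C₂, hC₂, hslab⟩ := exists_count_slabSet_height_le n hT
  obtain ⟨C₃, hC₃, hdef⟩ := exists_slabDefect_le hT hG
  refine ⟨C₁ + C₂ + C₂ + C₁ * (1 + D) + C₃, by positivity, ?_⟩
  filter_upwards [eventually_ge_atTop 1, eventually_ge_atTop θ⁻¹, eventually_ge_atTop κ⁻¹] with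
    S hS hSθ hSκ x y hx
  have hS0 : 0 < S := by linarith
  have hN := norm_nonneg (x - y)
  have hθS : 1 ≤ θ * S := by
    rw [← mul_inv_cancel₀ hθ.ne']; gcongr
  have hθS' : (θ * S) ^ n ≤ S ^ n := pow_le_pow_left₀ (by linarith) (by nlinarith) n
  have e1 : Measure.count (farSet R T κ θ S x y) ≤ ENNReal.ofReal (C₁ * S ^ n * (1 + ‖x - y‖)) :=
    (hfar R S x y hSκ).trans (ENNReal.ofReal_le_ofReal (by gcongr; linarith))
  have e2 : Measure.count (highSet R T θ S x y) ≤ ENNReal.ofReal (C₂ * S ^ n * (1 + ‖x - y‖)) :=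
    (measure_mono fun z hz => hz.1).trans (hslab R S x x y hS)
  have e3 : Measure.count (edgeSet R T θ S x y) ≤ ENNReal.ofReal (C₂ * S ^ n * (1 + ‖x - y‖)) :=
    (measure_mono fun z hz => hz.1).trans ((hslab R (θ * S) 0 x y hθS).trans
      (ENNReal.ofReal_le_ofReal (by gcongr)))
  have e4 : Measure.count (farSet R T κ θ S 0 y) ≤
      ENNReal.ofReal (C₁ * (1 + D) * S ^ n * (1 + ‖x - y‖)) := by
    refine (hfar R S 0 y hSκ).trans (ENNReal.ofReal_le_ofReal ?_)
    -- The far set based at `0` is governed by `‖y‖`, comparable to `1 + ‖x - y‖` because `x` is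
    -- bounded by `D`.
    have h1 : ‖(0 : Space n) - y‖ ≤ (1 + D) * (1 + ‖x - y‖) := by
      have : ‖(0 : Space n) - y‖ ≤ ‖x - y‖ + ‖x‖ := by
        rw [show (0 : Space n) - y = (x - y) - x by abel]
        exact norm_sub_le _ _
      nlinarith
    calc C₁ * S ^ n * ‖(0 : Space n) - y‖ ≤ C₁ * S ^ n * ((1 + D) * (1 + ‖x - y‖)) := by gcongr
      _ = _ := by ring
  have e5 : ENNReal.ofReal |slabDefect R T G (θ * S) x y| ≤
      ENNReal.ofReal (C₃ * S ^ n * (1 + ‖x - y‖)) :=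
    ENNReal.ofReal_le_ofReal ((hdef (θ * S) x y hθS).trans (by gcongr))
  refine (add_le_add (add_le_add (add_le_add (add_le_add e1 e2) e3) e4) e5).trans (le_of_eq ?_)
  rw [← ENNReal.ofReal_add, ← ENNReal.ofReal_add, ← ENNReal.ofReal_add, ← ENNReal.ofReal_add]
  · congr 1; ring
  all_goals positivity

/-! ### The cell value is finite and sublinear. -/

theorem energy_add_le {L : Set (Space n)} (c : L → L → ℝ≥0) (u v : L → ℝ) (A : Set (Space n)) :
    energy c (fun x => u x + v x) A ≤ energy c u A + energy c v A := by
  rw [energy, energy, energy, ← ENNReal.tsum_add]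
  refine ENNReal.tsum_le_tsum fun i => ?_
  rw [← ENNReal.tsum_add]
  refine ENNReal.tsum_le_tsum fun j => ?_
  rw [← mul_add]
  gcongr
  rw [add_sub_add_comm]
  exact ENNReal.ofReal_add_le

theorem energy_const_mul {L : Set (Space n)} (c : L → L → ℝ≥0) (u : L → ℝ) (A : Set (Space n))
    {t : ℝ} (ht : 0 ≤ t) :
    energy c (fun x => t * u x) A = ENNReal.ofReal t * energy c u A := by
  rw [energy, energy, ← ENNReal.tsum_mul_left]
  refine tsum_congr fun i => ?_
  rw [← ENNReal.tsum_mul_left]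
  refine tsum_congr fun j => ?_
  rw [← mul_sub, ENNReal.ofReal_mul ht]
  ring

theorem periodicCell_add_le {L : Set (Space n)} (T : ℕ) (c : L → L → ℝ≥0) (μ ν : Space n) :
    periodicCell T c (μ + ν) ≤ periodicCell T c μ + periodicCell T c ν := by
  -- Moving a summand to the left leaves a bare infimum on the right, to be tested on each
  -- competitor.
  rw [← tsub_le_iff_right]
  refine le_iInf₂ fun u hu => ?_
  rw [tsub_le_iff_right, ← tsub_le_iff_left]
  refine le_iInf₂ fun v hv => ?_
  rw [tsub_le_iff_left]
  refine le_trans (iInf₂_le (fun x => u x + v x) ?_) (energy_add_le c u v _)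
  intro z x y hxy
  have h1 := hu z x y hxy
  have h2 := hv z x y hxy
  simp only [inner_add_left] at h1 h2 ⊢
  linarith

theorem periodicCell_smul {L : Set (Space n)} (T : ℕ) (c : L → L → ℝ≥0) (ν : Space n) {t : ℝ}
    (ht : 0 < t) : periodicCell T c (t • ν) = ENNReal.ofReal t * periodicCell T c ν := by
  have key : ∀ (ν : Space n) {t : ℝ}, 0 < t →
      periodicCell T c (t • ν) ≤ ENNReal.ofReal t * periodicCell T c ν := by
    intro ν t ht
    have ht0 : ENNReal.ofReal t ≠ 0 := by simpa using ht
    rw [mul_comm, ← ENNReal.div_le_iff_le_mul (Or.inl ht0) (Or.inl ENNReal.ofReal_ne_top)]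
    refine le_iInf₂ fun u hu => ?_
    rw [ENNReal.div_le_iff_le_mul (Or.inl ht0) (Or.inl ENNReal.ofReal_ne_top), mul_comm,
      ← energy_const_mul c u _ ht.le]
    refine iInf₂_le (fun x => t * u x) ?_
    intro z x y hxy
    have h1 := hu z x y hxy
    simp only [real_inner_smul_left, ← mul_sub] at h1 ⊢
    rw [h1]
  refine le_antisymm (key ν ht) ?_
  have h1 := key (t • ν) (inv_pos.2 ht)
  rw [smul_smul, inv_mul_cancel₀ ht.ne', one_smul] at h1
  calc ENNReal.ofReal t * periodicCell T c ν
      ≤ ENNReal.ofReal t * (ENNReal.ofReal t⁻¹ * periodicCell T c (t • ν)) := by gcongr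
    _ = periodicCell T c (t • ν) := by
        rw [← mul_assoc, ← ENNReal.ofReal_mul ht.le, mul_inv_cancel₀ ht.ne', ENNReal.ofReal_one,
          one_mul]

theorem periodicCell_zero {L : Set (Space n)} (T : ℕ) (c : L → L → ℝ≥0) :
    periodicCell T c 0 = 0 := by
  refine le_antisymm ((iInf₂_le (fun _ => 0) ?_).trans (by simp [energy])) zero_le
  intro z x y _
  simp

/-- The linear function itself is a competitor, of finite energy by (H2). -/
theorem periodicCell_ne_top {L : Set (Space n)} (hL : UniformlyDiscrete L) (T : ℕ)
    {c : L → L → ℝ≥0} (hd : DecayCoeff c) (ν : Space n) : periodicCell T c ν ≠ ⊤ := by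
  refine ne_top_of_le_ne_top ?_ (iInf₂_le (fun x : L => inner ℝ ν (x : Space n)) ?_)
  · rw [energy_cube_eq]
    refine tsum_coeff_mul_ne_top hL hd (norm_nonneg ν) (fun i j => ?_) (by simp)
    refine ENNReal.ofReal_le_ofReal ?_
    rw [← inner_sub_right]
    refine (real_inner_le_norm _ _).trans ?_
    gcongr
    linarith
  · intro z x y _
    simp

/-! ### The lower bound and the inner limit. -/

/-- Insert the competitor built at scale `θ S` into the cell problem and pull out its slope by
homogeneity. The annulus energy of the flat interface is kept on the left, since the inner limit
contains it. -/
theorem dirichletCell_lower_bound {T : ℕ} (hT : 0 < T) {L : Set (Space n)}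
    (hL : UniformlyDiscrete L) (hP : PeriodicSet T L) {c : L → L → ℝ≥0} (hc : PeriodicCoeff T c)
    (hd : DecayCoeff c) {R : Space n ≃ₗᵢ[ℝ] Space n} {ν : Space n}
    (hR : R (lastBasisVector n) = ν) {G : ℝ → ℝ} (hG : IsLimitDistribution R T G)
    {δ θ : ℝ} (hδ : δ < 1) (hθ : 1 - δ < θ) (hθ1 : θ ≤ 1) :
    ∃ err : ℝ → ℝ≥0∞, Tendsto err atTop (𝓝 0) ∧ ∀ᶠ S : ℝ in atTop,
      ENNReal.ofReal (θ ^ n / (T : ℝ) ^ (n + 1)) * periodicCell T c ν +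
        energy c (levelSpin (fun x : L => height R x) 0) (R '' cube n S \ R '' cube n (θ * S)) /
          ENNReal.ofReal (S ^ n) ≤
      dirichletCell c R ν δ S / ENNReal.ofReal (S ^ n) + err S := by
  have hκ : 0 < 1 - δ := by linarith
  set κ := 1 - δ with hκδ
  have hθ0 : 0 < θ := hκ.trans hθ
  have hT' : (0 : ℝ) < (T : ℝ) ^ (n + 1) := pow_pos (by exact_mod_cast hT) _
  obtain ⟨D, hD0, hD⟩ := exists_norm_le_of_mem_cube n T
  obtain ⟨C, hC, hbd⟩ := exists_lowerError_le hT hG hκ hθ hθ1 hD0.le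
  set Er : ℝ → ℝ≥0∞ := fun S => ∑' i : Base T L, ∑' j : L, (c i j : ℝ≥0∞) *
    lowerError R T G κ θ S (i : L) j with hEr
  have hlarge : ∀ᶠ S : ℝ in atTop, 2 * D ≤ (θ - κ) * S := by
    filter_upwards [eventually_ge_atTop (2 * D / (θ - κ))] with S hS
    rwa [div_le_iff₀' (sub_pos.2 hθ)] at hS
  refine ⟨fun S => Er S / ENNReal.ofReal (S ^ n), ?_, ?_⟩
  · have := tendsto_tsum_coeff_mul (T := T) hL hd hC
      (f := fun S i j => lowerError R T G κ θ S (i : L) j) (F := fun _ _ => 0) ?_ ?_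
      (fun i j => tendsto_lowerError hT hG hκ hθ _ _)
    · simpa using this
    · filter_upwards [hbd] with S hS i j using hS _ _ (hD _ i.2)
    · filter_upwards [hlarge, eventually_ge_atTop 0] with S hS hS0 i
      have hi := hD _ i.2
      have h1 : farSet R T κ θ S ((i : L) : Space n) (i : L) = ∅ :=
        farSet_eq_empty R T (by rw [sub_self, norm_zero]; linarith)
      have h2 : farSet R T κ θ S 0 ((i : L) : Space n) = ∅ :=
        farSet_eq_empty R T (by rw [zero_sub, norm_neg]; linarith)
      have h3 : ∀ (S a : ℝ) (x : Space n), slabSet R T S x a a = ∅ := fun S a x =>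
        Set.eq_empty_of_forall_notMem fun z hz => absurd hz.2.2 (not_lt.2 hz.2.1)
      simp [lowerError, h1, h2, highSet, edgeSet, slabDefect, h3]
  · filter_upwards [hlarge, eventually_gt_atTop 0, eventually_ge_atTop κ⁻¹] with S hSD hS0 hSκ
    have hκS : 1 ≤ κ * S := by
      rw [← mul_inv_cancel₀ hκ.ne']; gcongr
    have hSn : 0 < S ^ n := by positivity
    have hSn0 : ENNReal.ofReal (S ^ n) ≠ 0 := by simpa using hSn
    have main : periodicCell T c (((θ * S) ^ n / (T : ℝ) ^ (n + 1)) • ν) +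
        energy c (levelSpin (fun x : L => height R x) 0) (R '' cube n S \ R '' cube n (θ * S)) ≤
        dirichletCell c R ν δ S + Er S := by
      rw [← tsub_le_iff_right]
      refine le_iInf₂ fun u hu => ?_
      rw [tsub_le_iff_right]
      have hu' : ∀ x : L, (x : Space n) ∉ R '' cube n (κ * S) →
          u x = levelSpin (fun x : L => height R x) 0 x := fun x hx => by
        rw [hu.2 x hx, halfSpaceSpin_eq_levelSpin hR]
      refine (add_le_add (iInf₂_le (periodicCompetitor hP R G (θ * S) u)
        (periodicFun_periodicCompetitor hP hR hG (θ * S) u)) le_rfl).trans ?_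
      rw [energy_cube_eq, energy_eq_tsum hT hP hc, energy_eq_tsum hT hP hc, hEr,
        ← ENNReal.tsum_add, ← ENNReal.tsum_add]
      refine ENNReal.tsum_le_tsum fun i => ?_
      rw [← ENNReal.tsum_add, ← ENNReal.tsum_add]
      refine ENNReal.tsum_le_tsum fun j => ?_
      rw [← mul_add, ← mul_add]
      refine mul_le_mul' le_rfl ?_
      have h1 := ofReal_periodicCompetitor_sub_le hT hP R G hκS (by positivity) hSD hu.1 hu'
        (hD _ i.2) j
      have h2 := ENNReal.tsum_le_tsum fun z => indicator_cylinder_add_annulus_le hP R hS0.le hθ.le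
        hθ1 hu.1 hu' i j z
      rw [ENNReal.tsum_add, ENNReal.tsum_add, tsum_indicator_one] at h2
      have h3 : Measure.count (farSet R T κ θ S ((i : L) : Space n) j ∪
          highSet R T θ S ((i : L) : Space n) j ∪ edgeSet R T θ S ((i : L) : Space n) j) ≤
          Measure.count (farSet R T κ θ S ((i : L) : Space n) j) +
          Measure.count (highSet R T θ S ((i : L) : Space n) j) +
          Measure.count (edgeSet R T θ S ((i : L) : Space n) j) :=
        (measure_union_le _ _).trans (add_le_add (measure_union_le _ _) le_rfl)
      refine (add_le_add h1 le_rfl).trans ?_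
      rw [lowerError, pairEnergy, pairEnergy]
      have h4 := add_le_add (add_le_add (h2.trans (add_le_add le_rfl h3))
        (le_refl (Measure.count (farSet R T κ θ S 0 (j : Space n)))))
        (le_refl (ENNReal.ofReal |slabDefect R T G (θ * S) (i : L) j|))
      convert h4 using 1 <;> ring
    have hpow : (θ * S) ^ n / (T : ℝ) ^ (n + 1) = θ ^ n / (T : ℝ) ^ (n + 1) * S ^ n := by
      rw [mul_pow]; ring
    rw [periodicCell_smul T c ν (by positivity), hpow, ENNReal.ofReal_mul (by positivity)] at main
    have := ENNReal.div_le_div_right main (ENNReal.ofReal (S ^ n))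
    rw [ENNReal.add_div, ENNReal.add_div, mul_right_comm,
      ENNReal.mul_div_cancel_right hSn0 ENNReal.ofReal_ne_top] at this
    exact this

theorem isEquivariant_of_periodicFun {T : ℕ} {L : Set (Space n)} (hP : PeriodicSet T L)
    {R : Space n ≃ₗᵢ[ℝ] Space n} {ν : Space n} (hR : R (lastBasisVector n) = ν) {u : L → ℝ}
    (hu : PeriodicFun T fun i : L => u i - inner ℝ ν (i : Space n)) : IsEquivariant hP R u := by
  intro x z
  have := hu z x (translate hP x z) rfl
  simp only [inner_eq_height hR, coe_translate, height_add] at this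
  linarith

theorem ofReal_natCast_pow (T k : ℕ) : ENNReal.ofReal ((T : ℝ) ^ k) = (T : ℝ≥0∞) ^ k := by
  rw [ENNReal.ofReal_pow (by positivity), ENNReal.ofReal_natCast]

/-- The inner limit: a mixture of the cell formula density and the flat interface density. -/
theorem tendsto_dirichletCell {T : ℕ} (hT : 0 < T) {L : Set (Space n)}
    (hL : UniformlyDiscrete L) (hP : PeriodicSet T L) {c : L → L → ℝ≥0} (hc : PeriodicCoeff T c)
    (hd : DecayCoeff c) {R : Space n ≃ₗᵢ[ℝ] Space n} {ν : Space n}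
    (hR : R (lastBasisVector n) = ν) {G : ℝ → ℝ} (hG : IsLimitDistribution R T G)
    {δ : ℝ} (hδ : δ ∈ Set.Ioo (0 : ℝ) 1) :
    Tendsto (fun S : ℝ => dirichletCell c R ν δ S / ENNReal.ofReal (S ^ n)) atTop
      (𝓝 (ENNReal.ofReal ((1 - δ) ^ n / (T : ℝ) ^ (n + 1)) * periodicCell T c ν +
        ENNReal.ofReal (1 - (1 - δ) ^ n) *
          levelDensity T c G (fun x : L => height R x) 0)) := by
  set κ := 1 - δ with hκδ
  have hκ : 0 < κ := by linarith [hδ.2]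
  have hκ1 : κ < 1 := by linarith [hδ.1]
  have hT' : (0 : ℝ) < (T : ℝ) ^ (n + 1) := pow_pos (by exact_mod_cast hT) _
  set e := levelDensity T c G (fun x : L => height R x) 0 with he
  have hefin : e ≠ ⊤ :=
    (tendsto_energy_levelSpin hT hL hc hd hG (isEquivariant_height hP R) 0).2
  set K := ENNReal.ofReal (1 - κ ^ n) * e with hK
  refine tendsto_of_le_liminf_of_limsup_le ?_ ?_
  -- The lower bound needs the buffer `κ < θ`; letting `θ ↓ κ` afterwards removes it.
  · have hcont : Tendsto (fun θ : ℝ => ENNReal.ofReal (θ ^ n / (T : ℝ) ^ (n + 1)) *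
        periodicCell T c ν + ENNReal.ofReal (1 - θ ^ n) * e) (𝓝[>] κ)
        (𝓝 (ENNReal.ofReal (κ ^ n / (T : ℝ) ^ (n + 1)) * periodicCell T c ν +
          ENNReal.ofReal (1 - κ ^ n) * e)) := by
      have hid : Tendsto (fun θ : ℝ => θ) (𝓝[>] κ) (𝓝 κ) :=
        tendsto_nhdsWithin_of_tendsto_nhds tendsto_id
      refine Tendsto.add ?_ ?_
      · exact ENNReal.Tendsto.mul_const (ENNReal.tendsto_ofReal ((hid.pow n).div_const _))
          (Or.inr (periodicCell_ne_top hL T hd ν))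
      · exact ENNReal.Tendsto.mul_const (ENNReal.tendsto_ofReal
          (tendsto_const_nhds.sub (hid.pow n))) (Or.inr hefin)
    refine le_of_tendsto hcont ?_
    filter_upwards [Ioo_mem_nhdsGT hκ1] with θ hθ
    obtain ⟨err, herr, hle⟩ := dirichletCell_lower_bound hT hL hP hc hd hR hG hδ.2 hθ.1 hθ.2.le
    have hann := tendsto_energy_annulus hT hL hc hd hG (isEquivariant_height hP R) 0
      (hκ.trans hθ.1) hθ.2.le
    have hlo := ENNReal.Tendsto.sub ((tendsto_const_nhds (x :=
      ENNReal.ofReal (θ ^ n / (T : ℝ) ^ (n + 1)) * periodicCell T c ν)).add hann) herr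
      (Or.inr ENNReal.zero_ne_top)
    rw [tsub_zero] at hlo
    rw [← hlo.liminf_eq]
    refine liminf_le_liminf ?_
    filter_upwards [hle] with S hS
    rw [tsub_le_iff_right]
    exact hS
  -- The factor of the cell value is nonzero and finite, so the infimum can be isolated and each `v`
  -- treated separately with its best level `t`.
  · have hb0 : ENNReal.ofReal (κ ^ n / (T : ℝ) ^ (n + 1)) ≠ 0 := by
      rw [Ne, ENNReal.ofReal_eq_zero, not_le]; positivity
    rw [← tsub_le_iff_right, mul_comm, ← ENNReal.div_le_iff_le_mul (Or.inl hb0)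
      (Or.inl ENNReal.ofReal_ne_top)]
    refine le_iInf₂ fun v hv => ?_
    rw [ENNReal.div_le_iff_le_mul (Or.inl hb0) (Or.inl ENNReal.ofReal_ne_top), tsub_le_iff_right]
    obtain ⟨t, ht⟩ := exists_levelDensity_le hT hL hP c hG v
    obtain ⟨f, hf, hlim⟩ := dirichletCell_upper_bound hT hL hc hd hR hG
      (isEquivariant_of_periodicFun hP hR hv) t hδ
    rw [← hκδ] at hlim
    calc _ ≤ limsup f atTop := limsup_le_limsup (Eventually.of_forall hf)
      _ = _ := hlim.limsup_eq
      _ ≤ _ := by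
        refine add_le_add ?_ le_rfl
        refine (mul_le_mul' le_rfl ht).trans (le_of_eq ?_)
        rw [ENNReal.ofReal_div_of_pos hT', div_eq_mul_inv, div_eq_mul_inv]
        ring

/-! ### The homogenized density and its uniqueness. -/

/-- The density given by the periodic cell formula. -/
def cellDensity {L : Set (Space n)} (T : ℕ) (c : L → L → ℝ≥0) (ν : Space n) : ℝ≥0 :=
  (periodicCell T c ν / (T : ℝ≥0∞) ^ (n + 1)).toNNReal

theorem coe_cellDensity {T : ℕ} (hT : 0 < T) {L : Set (Space n)} (hL : UniformlyDiscrete L)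
    {c : L → L → ℝ≥0} (hd : DecayCoeff c) (ν : Space n) :
    (cellDensity T c ν : ℝ≥0∞) = periodicCell T c ν / (T : ℝ≥0∞) ^ (n + 1) :=
  ENNReal.coe_toNNReal (ENNReal.div_ne_top (periodicCell_ne_top hL T hd ν)
    (pow_ne_zero _ (by exact_mod_cast hT.ne')))

theorem cellDensity_smul {T : ℕ} (hT : 0 < T) {L : Set (Space n)} (hL : UniformlyDiscrete L)
    {c : L → L → ℝ≥0} (hd : DecayCoeff c) (t : ℝ≥0) (ν : Space n) :
    cellDensity T c ((t : ℝ) • ν) = t * cellDensity T c ν := by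
  rw [← ENNReal.coe_inj, ENNReal.coe_mul, coe_cellDensity hT hL hd, coe_cellDensity hT hL hd]
  rcases eq_or_ne t 0 with rfl | ht
  · simp [periodicCell_zero]
  · rw [periodicCell_smul T c ν (by positivity), ENNReal.ofReal_coe_nnreal, mul_div_assoc]

theorem cellDensity_add_le {T : ℕ} (hT : 0 < T) {L : Set (Space n)} (hL : UniformlyDiscrete L)
    {c : L → L → ℝ≥0} (hd : DecayCoeff c) (μ ν : Space n) :
    cellDensity T c (μ + ν) ≤ cellDensity T c μ + cellDensity T c ν := by
  rw [← ENNReal.coe_le_coe, ENNReal.coe_add, coe_cellDensity hT hL hd, coe_cellDensity hT hL hd,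
    coe_cellDensity hT hL hd, ← ENNReal.add_div]
  exact ENNReal.div_le_div_right (periodicCell_add_le T c μ ν) _

theorem isHomogenizedDensity_cellDensity {T : ℕ} (hT : 0 < T) {L : Set (Space n)}
    (hL : UniformlyDiscrete L) (hP : PeriodicSet T L)
    {R : Space n → (Space n ≃ₗᵢ[ℝ] Space n)} (hR : IsFrameChoice R)
    {c : L → L → ℝ≥0} (hc : PeriodicCoeff T c) (hd : DecayCoeff c) :
    IsHomogenizedDensity c R (cellDensity T c) where
  convex := by
    refine ⟨convex_univ, fun x _ y _ a b ha hb _ => ?_⟩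
    lift a to ℝ≥0 using ha
    lift b to ℝ≥0 using hb
    have := cellDensity_add_le hT hL hd ((a : ℝ) • x) ((b : ℝ) • y)
    rw [cellDensity_smul hT hL hd, cellDensity_smul hT hL hd] at this
    exact_mod_cast this
  homogeneous t ν _ := cellDensity_smul hT hL hd t ν
  cell_limit ν hν := by
    obtain ⟨G, hG⟩ := exists_isLimitDistribution hT (R ν)
    refine ⟨_, fun δ hδ => tendsto_dirichletCell hT hL hP hc hd (hR ν hν) hG hδ, ?_⟩
    have hefin : levelDensity T c G (fun x : L => height (R ν) x) 0 ≠ ⊤ :=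
      (tendsto_energy_levelSpin hT hL hc hd hG (isEquivariant_height hP (R ν)) 0).2
    have hT' : (0 : ℝ) < (T : ℝ) ^ (n + 1) := pow_pos (by exact_mod_cast hT) _
    have hid : Tendsto (fun δ : ℝ => (1 - δ) ^ n) (𝓝[>] 0) (𝓝 1) := by
      have : Tendsto (fun δ : ℝ => (1 - δ) ^ n) (𝓝 0) (𝓝 ((1 - 0) ^ n)) :=
        ((continuous_const.sub continuous_id).pow n).tendsto 0
      rw [sub_zero, one_pow] at this
      exact tendsto_nhdsWithin_of_tendsto_nhds this
    have h1 := ENNReal.Tendsto.mul_const (b := periodicCell T c ν)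
      (ENNReal.tendsto_ofReal (hid.div_const ((T : ℝ) ^ (n + 1))))
      (Or.inr (periodicCell_ne_top hL T hd ν))
    -- The weight `1 - (1 - δ)^n` of the flat interface tends to `0` and its density is finite, so
    -- this term disappears.
    have h2 := ENNReal.Tendsto.mul_const
      (ENNReal.tendsto_ofReal ((tendsto_const_nhds (x := (1 : ℝ))).sub hid)) (Or.inr hefin)
    have h3 := h1.add h2
    rw [sub_self, ENNReal.ofReal_zero, zero_mul, add_zero, ENNReal.ofReal_div_of_pos hT',
      ENNReal.ofReal_one, one_div, mul_comm, ← div_eq_mul_inv, ofReal_natCast_pow,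
      ← coe_cellDensity hT hL hd] at h3
    exact h3

/-- Uniqueness of limits fixes the value on unit vectors. The two inner limits agree only for `δ` in
`(0, 1)`, which suffices near `0⁺`. Scaling reaches the other nonzero vectors, and `χ 0 = 2 * χ 0`
settles the origin. -/
theorem IsHomogenizedDensity.eq {L : Set (Space n)} {c : L → L → ℝ≥0}
    {R : Space n → (Space n ≃ₗᵢ[ℝ] Space n)} {φ ψ : Space n → ℝ≥0}
    (hφ : IsHomogenizedDensity c R φ) (hψ : IsHomogenizedDensity c R ψ) : φ = ψ := by
  have hunit : ∀ ν : Space n, ‖ν‖ = 1 → φ ν = ψ ν := by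
    intro ν hν
    obtain ⟨g, hg, hg'⟩ := hφ.cell_limit ν hν
    obtain ⟨h, hh, hh'⟩ := hψ.cell_limit ν hν
    rw [← ENNReal.coe_inj]
    refine tendsto_nhds_unique (hg'.congr' ?_) hh'
    filter_upwards [Ioo_mem_nhdsGT one_pos] with δ hδ
    exact tendsto_nhds_unique (hg δ hδ) (hh δ hδ)
  have hzero : ∀ {χ : Space n → ℝ≥0}, IsHomogenizedDensity c R χ → χ 0 = 0 := by
    intro χ hχ
    have := hχ.homogeneous 2 0 two_pos
    rw [smul_zero, two_mul] at this
    exact left_eq_add.1 this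
  funext ν
  rcases eq_or_ne ν 0 with rfl | hν
  · rw [hzero hφ, hzero hψ]
  · have hpos : 0 < ‖ν‖₊ := nnnorm_pos.2 hν
    have hdec : ν = ((‖ν‖₊ : ℝ≥0) : ℝ) • ((‖ν‖⁻¹ : ℝ) • ν) := by
      rw [coe_nnnorm, smul_smul, mul_inv_cancel₀ (norm_ne_zero_iff.2 hν), one_smul]
    rw [hdec, hφ.homogeneous _ _ hpos, hψ.homogeneous _ _ hpos, hunit]
    rw [norm_smul, norm_inv, norm_norm, inv_mul_cancel₀ (norm_ne_zero_iff.2 hν)]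

end SpinHomogenization

end

theorem proposition2p6 (n T : ℕ) (hT : 0 < T)
    (L : Set (SpinHomogenization.Space n))
    (hL1 : SpinHomogenization.UniformlyDiscrete L)
    (hL2 : SpinHomogenization.PeriodicSet T L)
    (R : SpinHomogenization.Space n →
      (SpinHomogenization.Space n ≃ₗᵢ[ℝ] SpinHomogenization.Space n))
    (hR : SpinHomogenization.IsFrameChoice R)
    (c : L → L → ℝ≥0)
    (hH1 : SpinHomogenization.PeriodicCoeff T c)
    (hH2 : SpinHomogenization.DecayCoeff c) :
    (∃! φ : SpinHomogenization.Space n → ℝ≥0, SpinHomogenization.IsHomogenizedDensity c R φ) ∧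
    ∀ φ : SpinHomogenization.Space n → ℝ≥0, SpinHomogenization.IsHomogenizedDensity c R φ →
      ∀ ν : SpinHomogenization.Space n,
        (φ ν : ℝ≥0∞) = SpinHomogenization.periodicCell T c ν / (T : ℝ≥0∞) ^ (n + 1) := by
  have h := SpinHomogenization.isHomogenizedDensity_cellDensity hT hL1 hL2 hR hH1 hH2
  refine ⟨⟨_, h, fun ψ hψ => hψ.eq h⟩, fun φ hφ ν => ?_⟩
  rw [hφ.eq h, SpinHomogenization.coe_cellDensity hT hL1 hH2]
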